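/- A real rational function $g$ is in $\mathbb{RL}_\infty$ if it is bounded on the imaginary axis (in particular it has no poles there), and in $\mathbb{RH}_\infty$ if moreover all its poles lie in the open left half plane. Put $\|g\|_{L_\infty}=\sup_{\omega\in\mathbb R}|g(j\omega)|$ and $\|\delta\|_{H_\infty}=\sup_{\Re s>0}|\delta(s)|$. For $n\in\mathbb N$ let $\mathcal G_n$ be the set of strictly proper, unstable $g\in\mathbb{RL}_\infty$ that have exactly $n$ poles with positive real part (counted with multiplicity) and satisfy the parity interlacing property: between any two distinct real zeros of $g$ in $[0,\infty]$ (the zero at $\infty$ included) there is an even number of real poles of $g$, counted with multiplicity. Let $$\mathcal G_n^0=\{g\in\mathcal G_n:\ \|g\|_{L_\infty}=|g(0)|>|g(j\omega)|\ \ \forall\omega\ne0\},$$ $$\mathcal G_n^\#=\{g\in\mathcal G_n:\ \exists\,\omega_p>0,\ \|g\|_{L_\infty}=|g(j\omega_p)|>|g(j\omega)|\ \ \forall\omega\neq\pm\omega_p\};$$ for $g\in\mathcal G_n^\#$ the number $\omega_p>0$ is its peak frequency. The robust instability radius of $g$ is $$\rho_*(g)=\inf_{\delta\in\mathbb S(g)}\|\delta\|_{H_\infty}\in[0,\infty],\qquad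 \inf\emptyset=\infty,$$ where $\mathbb S(g)$ is the set of all $\delta\in\mathbb{RH}_\infty$ that internally stabilize $g$ in positive feedback, i.e. such that $\delta(s)g(s)=1$ implies $\Re s<0$, and no zero $s$ of $\delta$ with $\Re s>0$ is a pole of $g$. Let $\theta_g(\omega)$ be any angle of $g(j\omega)$ that is chosen continuously in $\omega$ on $\{\omega\in\mathbb R: g(j\omega)\neq0\}$, and $\theta_g'$ its derivative in $\omega$. **Theorem.** (I) Let $g\in\mathcal G_1^0$. If $\theta_g'(0)>0$, then $\rho_*(g)=1/\|g\|_{L_\infty}=1/|g(0)|$. Conversely, if $\rho_*(g)=1/\|g\|_{L_\infty}=1/|g(0)|$, then $\theta_g'(0)\ge0$. (II) Let $g\in\mathcal G_2^\#$ with peak frequency $\omega_p>0$. If $\theta_g'(\omega_p)>\left|\frac{\sin\theta_g(\omega_p)}{\omega_p}\right|$, then $\rho_*(g)=1/\|g\|_{L_\infty}=1/|g(j\omega_p)|$. Conversely, if $\rho_*(g)=1/\|g\|_{L_\infty}=1/|g(j\omega_p)|$, then $\theta_g'(\omega_p)\ge\left|\frac{\sin\theta_g(\omega_p)}{\omega_p}\right|$.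 (III) For every $g\in\mathcal G_1^\#$, $\rho_*(g)>1/\|g\|_{L_\infty}$. -/

import Mathlib

open scoped ENNReal

noncomputable section

namespace RobustInstability

/-- The value at `s : ℂ` of a real rational function. At a pole of `g` this is the value `0`,
so poles are always treated explicitly through `IsPole`. -/
def tf (g : RatFunc ℝ) (s : ℂ) : ℂ := g.eval (algebraMap ℝ ℂ) s

/-- `s` is a pole of `g` (numerator and denominator of a `RatFunc` are coprime). -/
def IsPole (g : RatFunc ℝ) (s : ℂ) : Prop := Polynomial.aeval s g.denom = 0

/-- The frequency response `ω ↦ g (jω)`. -/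
def freq (g : RatFunc ℝ) (ω : ℝ) : ℂ := tf g (ω * Complex.I)

/-- Real rational functions that are bounded on the imaginary axis. -/
def IsRLinf (g : RatFunc ℝ) : Prop :=
  (∀ ω : ℝ, ¬ IsPole g (ω * Complex.I)) ∧ ∃ C : ℝ, ∀ ω : ℝ, ‖freq g ω‖ ≤ C

/-- All poles lie in the open left half plane. -/
def IsStable (g : RatFunc ℝ) : Prop := ∀ s : ℂ, IsPole g s → s.re < 0

/-- The stable real rational functions that are bounded on the imaginary axis. -/
def IsRHinf (g : RatFunc ℝ) : Prop := IsRLinf g ∧ IsStable g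

/-- The `L∞` norm: the supremum of the gain over the imaginary axis. -/
def linfNorm (g : RatFunc ℝ) : ℝ≥0∞ := ⨆ ω : ℝ, ‖freq g ω‖ₑ

/-- The `H∞` norm: the supremum of the modulus over the open right half plane. -/
def hinfNorm (f : RatFunc ℝ) : ℝ≥0∞ := ⨆ (s : ℂ) (_ : 0 < s.re), ‖tf f s‖ₑ

def StrictlyProper (g : RatFunc ℝ) : Prop := g.num.degree < g.denom.degree

/-- The class of strictly proper unstable real rational functions without
poles on the imaginary axis. -/
def classG : Set (RatFunc ℝ) := {g | IsRLinf g ∧ StrictlyProper g ∧ ¬ IsStable g}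

/-- The number of poles in the open right half plane, counted with multiplicity. -/
def numUnstablePoles (g : RatFunc ℝ) : ℕ :=
  Multiset.countP (fun s : ℂ => 0 < s.re) (g.denom.aroots ℂ)

/-- `z` is a real zero of `g` in the closed right half plane; `z = ⊤` is the zero at infinity. -/
def IsRealZeroCRHP (g : RatFunc ℝ) (z : EReal) : Prop :=
  (∃ x : ℝ, 0 ≤ x ∧ g.num.eval x = 0 ∧ z = (x : EReal)) ∨ (StrictlyProper g ∧ z = ⊤)

/-- The number of real poles strictly between `a` and `b`, counted with multiplicity. -/
def numRealPolesBetween (g : RatFunc ℝ) (a b : EReal) : ℕ :=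
  Multiset.countP (fun x : ℝ => a < (x : EReal) ∧ (x : EReal) < b) g.denom.roots

/-- The parity interlacing property. -/
def PIP (g : RatFunc ℝ) : Prop :=
  ∀ a b : EReal, IsRealZeroCRHP g a → IsRealZeroCRHP g b → a < b →
    Even (numRealPolesBetween g a b)

/-- The members of `classG` with `n` unstable poles and the parity interlacing property. -/
def classGn (n : ℕ) : Set (RatFunc ℝ) := {g | g ∈ classG ∧ numUnstablePoles g = n ∧ PIP g}

/-- The gain attains its supremum at `± ωp` and at no other frequency. -/
def IsUniquePeak (g : RatFunc ℝ) (ωp : ℝ) : Prop :=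
  linfNorm g = ‖freq g ωp‖ₑ ∧ ∀ ω : ℝ, ω ≠ ωp → ω ≠ -ωp → ‖freq g ω‖ < ‖freq g ωp‖

/-- The members of `classGn n` with unique peak frequency `0`. -/
def classGnZero (n : ℕ) : Set (RatFunc ℝ) := {g | g ∈ classGn n ∧ IsUniquePeak g 0}

/-- The members of `classGn n` with a unique peak frequency that is positive. -/
def classGnSharp (n : ℕ) : Set (RatFunc ℝ) :=
  {g | g ∈ classGn n ∧ ∃ ωp : ℝ, 0 < ωp ∧ IsUniquePeak g ωp}

/-- The stable perturbations that internally stabilize `g` in positive feedback: all roots of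
`δ(s) g(s) = 1` lie in the open left half plane and no zero of `δ` cancels an unstable pole of `g`.
(At a pole of `g` or `δ` the left side of the equation reads `0` here, so that such points
are not counted as roots.) -/
def stabilizing (g : RatFunc ℝ) : Set (RatFunc ℝ) :=
  {δ | IsRHinf δ ∧ (∀ s : ℂ, tf δ s * tf g s = 1 → s.re < 0) ∧
    ∀ s : ℂ, tf δ s = 0 → 0 < s.re → ¬ IsPole g s}

/-- The robust instability radius, with infimum `⊤` if nothing stabilizes `g`. -/
def rir (g : RatFunc ℝ) : ℝ≥0∞ := ⨅ δ ∈ stabilizing g, hinfNorm δ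

/-- `θ` is a phase of the frequency response of `g`: an angle of `g (jω)`, chosen continuously in
`ω` wherever `g (jω) ≠ 0`. -/
def IsPhase (g : RatFunc ℝ) (θ : ℝ → ℝ) : Prop :=
  ContinuousOn θ {ω | freq g ω ≠ 0} ∧
    ∀ ω : ℝ, freq g ω = ‖freq g ω‖ * Complex.exp (θ ω * Complex.I)

end RobustInstability

end

open RobustInstability

/-!
Write `g = n / d` and let `δ = a / b` be a stable perturbation. Internal stability means that the
polynomial `b d - a n` has no root in the closed right half plane (`aeval_loop_ne_zero`). All of
the proof is about the motion of the roots of the pencil `b d - c a n` as the gain `c` varies. Its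
degree does not depend on `c`, since `g` is strictly proper, so the number of roots in an open set
can change only when a root meets the frontier (`countP_roots_pencil_eq`). Applied to the right half
plane this is the small gain bound `1 / ‖g‖ ≤ ρ_*(g)` (`inv_linfNorm_le_rir`).

*Sufficiency.* Choose an all-pass `δ₀` of order at most one whose phase at the peak cancels that of
`g`; its phase derivative there is `-|sin θ| / ωp` (`exists_allpass`), so the phase condition says
that `L = δ₀ g / ‖g‖` has positive derivative at the points `± jωp`, where `L = 1`, while `|L| < 1`
elsewhere on the imaginary axis. For `c < 1` the closed loop has as many unstable roots as `g` has
unstable poles, which is the number of the peak points. All of them are used up by the roots that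
cross the axis from right to left at the peak points as `c` passes `1`, so nothing unstable is left
for `c` slightly above `1` (`eventually_no_root_pencil`).

*Necessity with one unstable pole `p`.* The pole is real and simple, so `b d` changes sign on
`[0, ∞)` exactly at `p`, while `b d - a n` does not vanish there and both are positive at infinity.
Hence `δ g > 1` on `[0, p)` for every stabilising `δ` (`one_lt_norm_mul_of_stabilizing`), and
`ρ_*(g) ≥ 1 / |g x|` for `0 ≤ x < p`. At `x = 0` this excludes equality for a peak at a positive
frequency; near `x = 0` it shows that `|g|` does not decrease to the right of a peak at `0`, which
is the sign of the phase derivative (`deriv_tf_eq_deriv_phase_mul`).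

*Necessity at a positive peak frequency.* Remove small half discs around `± jωp` from the right half
plane. By the homotopy `t δ` with `t ∈ [0, 1]`, a stabilising `δ` must satisfy `t δ g = 1` somewhere
on the boundary of what remains (`exists_frontier_mul_eq_one`). If `‖δ‖` is close to `1 / ‖g‖`, that
point lies on one of the half circles. The Schwarz–Pick inequality for the points `s` and `conj s`
restricts the values of the real function `δ` there (`norm_one_sub_sq_mul_re_le`), and it
excludes `1 / (t g)` when `θ' < |sin θ| / ωp` (`exists_ball_pickDefect_neg`).
-/

namespace RobustInstability

open Polynomial Filter Topology Bornology ComplexConjugate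

/-! ### Roots of a pencil of complex polynomials -/

theorem exists_norm_root_le {E N : ℂ[X]} (h : N.degree < E.degree) (T : ℝ) :
    ∃ R : ℝ, ∀ c : ℂ, ‖c‖ ≤ T → ∀ s : ℂ, (E - C c * N).IsRoot s → ‖s‖ ≤ R := by
  have hE : E ≠ 0 := by rintro rfl; simp at h
  have h1 : ∀ᶠ s in cobounded ℂ, ‖N.eval s‖ ≤ (1 / (2 * (|T| + 1))) * ‖E.eval s‖ :=
    (isLittleO_cobounded_of_degree_lt h).bound (by positivity)
  have h2 : ∀ᶠ s in cobounded ℂ, E.eval s ≠ 0 := by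
    have : IsBounded {s | E.IsRoot s} := (E.finite_setOfPred_isRoot hE).isBounded
    filter_upwards [isBounded_def.1 this] with s hs using hs
  have h3 : IsBounded {s : ℂ | ¬ (‖N.eval s‖ ≤ (1 / (2 * (|T| + 1))) * ‖E.eval s‖ ∧
      E.eval s ≠ 0)} := by
    rw [isBounded_def]
    filter_upwards [h1, h2] with s hs hs' using by simpa using ⟨by simpa using hs, hs'⟩
  obtain ⟨R, hR⟩ := h3.exists_norm_le
  refine ⟨R, fun c hc s hs => hR s fun ⟨ha, hb⟩ => ?_⟩
  have h4 : E.eval s = c * N.eval s := by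
    simpa [IsRoot, sub_eq_zero] using hs
  have h5 : ‖E.eval s‖ = ‖c‖ * ‖N.eval s‖ := by rw [h4, norm_mul]
  have h6 : 0 < ‖E.eval s‖ := norm_pos_iff.2 hb
  have h7 : ‖c‖ * ‖N.eval s‖ ≤ |T| * (1 / (2 * (|T| + 1)) * ‖E.eval s‖) := by
    gcongr
    exact hc.trans (le_abs_self T)
  have h8 : |T| * (1 / (2 * (|T| + 1)) * ‖E.eval s‖) ≤ (1 / 2) * ‖E.eval s‖ := by
    rw [← mul_assoc]
    gcongr
    rw [mul_one_div, div_le_div_iff₀ (by positivity) (by norm_num)]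
    linarith
  linarith

theorem degree_C_mul_lt {E N : ℂ[X]} (h : N.degree < E.degree) (c : ℂ) :
    (C c * N).degree < E.degree :=
  lt_of_le_of_lt (by rw [← smul_eq_C_mul]; exact degree_smul_le c N) h

theorem natDegree_pencil {E N : ℂ[X]} (h : N.degree < E.degree) (c : ℂ) :
    (E - C c * N).natDegree = E.natDegree :=
  natDegree_eq_of_degree_eq (degree_sub_eq_left_of_degree_lt (degree_C_mul_lt h c))

theorem leadingCoeff_pencil {E N : ℂ[X]} (h : N.degree < E.degree) (c : ℂ) :
    (E - C c * N).leadingCoeff = E.leadingCoeff :=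
  leadingCoeff_sub_of_degree_lt (degree_C_mul_lt h c)

theorem pencil_ne_zero {E N : ℂ[X]} (h : N.degree < E.degree) (c : ℂ) : E - C c * N ≠ 0 := by
  intro h0
  have := leadingCoeff_pencil h c
  rw [h0, leadingCoeff_zero, eq_comm, leadingCoeff_eq_zero] at this
  simp [this] at h

theorem exists_roots_eq_map (P : ℂ[X]) {n : ℕ} (hn : P.natDegree = n) :
    ∃ z : Fin n → ℂ, P.roots = Multiset.map z Finset.univ.val := by
  obtain ⟨l, hl⟩ := Quot.exists_rep P.roots
  have hc : l.length = n := by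
    rw [← hn, ← IsAlgClosed.card_roots_eq_natDegree, ← hl]
    rfl
  subst hc
  exact ⟨l.get, by rw [Fin.univ_val_map, List.ofFn_get, ← hl]; rfl⟩

theorem eval_eq_prod_of_roots_eq_map {P : ℂ[X]} {n : ℕ} {z : Fin n → ℂ}
    (hz : P.roots = Multiset.map z Finset.univ.val) (s : ℂ) :
    P.eval s = P.leadingCoeff * ∏ i, (s - z i) := by
  rw [(IsAlgClosed.splits P).eval_eq_prod_roots, hz, Multiset.map_map]
  rfl

theorem roots_eq_map_of_eval_eq_prod {P : ℂ[X]} {n : ℕ} {z : Fin n → ℂ} {a : ℂ} (ha : a ≠ 0)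
    (h : ∀ s, P.eval s = a * ∏ i, (s - z i)) : P.roots = Multiset.map z Finset.univ.val := by
  have hP : P = C a * (Multiset.map (fun w => X - C w) (Multiset.map z Finset.univ.val)).prod := by
    refine Polynomial.funext fun s => ?_
    rw [h, eval_mul, eval_C, eval_multiset_prod, Multiset.map_map, Multiset.map_map]
    simp only [Function.comp_def, eval_sub, eval_X, eval_C]
    rfl
  rw [hP, roots_C_mul _ ha, roots_multiset_prod_X_sub_C]

open Classical in
/-- Along a pencil `E - c N` of constant degree, roots in `Ω` are neither created nor destroyed
as long as none of them meets the frontier of `Ω`. -/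
theorem countP_roots_pencil_eq {E N : ℂ[X]} (h : N.degree < E.degree) {Ω : Set ℂ}
    (hΩ : IsOpen Ω) {T : ℝ} (hT : 0 ≤ T)
    (hfr : ∀ c ∈ Set.Icc 0 T, ∀ s ∈ frontier Ω, ¬ (E - C (c : ℂ) * N).IsRoot s) :
    (E - C (T : ℂ) * N).roots.countP (· ∈ Ω) = E.roots.countP (· ∈ Ω) := by
  -- Subsequences of the root tuples converge, to a root tuple of the limit polynomial.
  have key : ContinuousOn (fun c : ℝ => (E - C (c : ℂ) * N).roots.countP (· ∈ Ω))
      (Set.Icc 0 T) := by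
    intro c hc
    refine tendsto_of_subseq_tendsto fun u hu => ?_
    have hu1 : Tendsto u atTop (𝓝 c) := hu.mono_right nhdsWithin_le_nhds
    have hu2 : ∀ᶠ k in atTop, u k ∈ Set.Icc 0 T := hu.eventually self_mem_nhdsWithin
    obtain ⟨R, hR⟩ := exists_norm_root_le h T
    choose z hz using fun k : ℕ => exists_roots_eq_map (E - C (u k : ℂ) * N)
      (natDegree_pencil h (u k : ℂ))
    have hzR : ∀ᶠ k in atTop, z k ∈ Set.pi Set.univ fun _ => Metric.closedBall (0 : ℂ) R := by
      filter_upwards [hu2] with k hk i _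
      rw [mem_closedBall_zero_iff]
      refine hR (u k : ℂ) ?_ _ ?_
      · rw [Complex.norm_real, Real.norm_of_nonneg hk.1]
        exact hk.2
      · rw [← mem_roots (pencil_ne_zero h _), hz k]
        exact Multiset.mem_map_of_mem _ (Finset.mem_univ_val i)
    obtain ⟨w, -, φ, hφ, hw⟩ :=
      (isCompact_univ_pi fun _ => isCompact_closedBall (0 : ℂ) R).tendsto_subseq' hzR.frequently
    rw [tendsto_pi_nhds] at hw
    refine ⟨φ, ?_⟩
    have hev : ∀ s, (E - C (c : ℂ) * N).eval s = E.leadingCoeff * ∏ i, (s - w i) := by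
      intro s
      have h1 : Tendsto (fun k => (E - C (u (φ k) : ℂ) * N).eval s) atTop
          (𝓝 ((E - C (c : ℂ) * N).eval s)) := by
        simp only [eval_sub, eval_mul, eval_C]
        refine tendsto_const_nhds.sub (Tendsto.mul_const _ ?_)
        exact (Complex.continuous_ofReal.tendsto c).comp (hu1.comp hφ.tendsto_atTop)
      have h2 : Tendsto (fun k => (E - C (u (φ k) : ℂ) * N).eval s) atTop
          (𝓝 (E.leadingCoeff * ∏ i, (s - w i))) := by
        have : ∀ k, (E - C (u (φ k) : ℂ) * N).eval s =
            E.leadingCoeff * ∏ i, (s - z (φ k) i) := fun k => by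
          rw [eval_eq_prod_of_roots_eq_map (hz (φ k)), leadingCoeff_pencil h]
        simp only [this]
        exact tendsto_const_nhds.mul (tendsto_finsetProd _ fun i _ =>
          tendsto_const_nhds.sub (hw i))
      exact tendsto_nhds_unique h1 h2
    have hE : E.leadingCoeff ≠ 0 := by
      rw [← leadingCoeff_pencil h (c : ℂ)]
      exact leadingCoeff_ne_zero.2 (pencil_ne_zero h _)
    have hroots := roots_eq_map_of_eval_eq_prod hE hev
    refine tendsto_const_nhds.congr' ?_
    have hmem : ∀ᶠ k in atTop, ∀ i, (z (φ k) i ∈ Ω ↔ w i ∈ Ω) := by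
      rw [eventually_all]
      intro i
      by_cases hi : w i ∈ Ω
      · filter_upwards [(hw i).eventually (hΩ.mem_nhds hi)] with k hk
        exact iff_of_true hk hi
      · have hcl : w i ∉ closure Ω := by
          intro hcl
          refine hfr c hc (w i) ?_ ?_
          · rw [hΩ.frontier_eq]
            exact ⟨hcl, hi⟩
          · rw [← mem_roots (pencil_ne_zero h _), hroots]
            exact Multiset.mem_map_of_mem _ (Finset.mem_univ_val i)
        filter_upwards [(hw i).eventually (isClosed_closure.isOpen_compl.mem_nhds hcl)] with k hk
        exact iff_of_false (fun h' => hk (subset_closure h')) hi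
    filter_upwards [hmem] with k hk
    simp only [hroots, hz, Multiset.countP_map, hk]
  have := isPreconnected_Icc.constant key (Set.right_mem_Icc.2 hT) (Set.left_mem_Icc.2 hT)
  simpa using this

open Classical in
theorem exists_root_mem_of_pencil {E N : ℂ[X]} (h : N.degree < E.degree) {Ω : Set ℂ}
    (hΩ : IsOpen Ω) (hfr : ∀ c ∈ Set.Icc (0 : ℝ) 1, ∀ s ∈ frontier Ω,
      ¬ (E - C (c : ℂ) * N).IsRoot s) {p : ℂ} (hp : p ∈ Ω) (hEp : E.IsRoot p) :
    ∃ s ∈ Ω, (E - N).IsRoot s := by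
  have h1 := countP_roots_pencil_eq h hΩ zero_le_one hfr
  have hE : E ≠ 0 := by rintro rfl; simp at h
  have h2 : 0 < E.roots.countP (· ∈ Ω) := Multiset.countP_pos.2 ⟨p, (mem_roots hE).2 hEp, hp⟩
  rw [← h1, Multiset.countP_pos] at h2
  obtain ⟨s, hs, hsΩ⟩ := h2
  exact ⟨s, hsΩ, by simpa using isRoot_of_mem_roots hs⟩

/-- A root of the pencil at `c₀` persists nearby for nearby parameters. -/
theorem eventually_exists_root_pencil {E N : ℂ[X]} (h : N.degree < E.degree) {c₀ : ℝ} {q : ℂ}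
    (hq : (E - C (c₀ : ℂ) * N).IsRoot q) {U : Set ℂ} (hU : U ∈ 𝓝 q) :
    ∀ᶠ c : ℝ in 𝓝 c₀, ∃ s ∈ U, (E - C (c : ℂ) * N).IsRoot s := by
  obtain ⟨ρ, hρ, hρU⟩ := Metric.mem_nhds_iff.1 hU
  have hE : 0 < ‖E.leadingCoeff‖ := by
    rw [norm_pos_iff, leadingCoeff_ne_zero]
    rintro rfl; simp at h
  have h1 : Tendsto (fun c : ℝ => ‖(E - C (c : ℂ) * N).eval q‖) (𝓝 c₀) (𝓝 0) := by
    have : ContinuousAt (fun c : ℝ => ‖(E - C (c : ℂ) * N).eval q‖) c₀ := by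
      simp only [eval_sub, eval_mul, eval_C]
      fun_prop
    have h0 : ‖(E - C (c₀ : ℂ) * N).eval q‖ = 0 := by rw [hq.eq_zero, norm_zero]
    rw [ContinuousAt, h0] at this
    exact this
  filter_upwards [h1.eventually (gt_mem_nhds (show 0 < ‖E.leadingCoeff‖ * ρ ^ E.natDegree by
    positivity))] with c hc
  by_contra! hcon
  obtain ⟨z, hz⟩ := exists_roots_eq_map _ (natDegree_pencil h (c : ℂ))
  rw [eval_eq_prod_of_roots_eq_map hz, leadingCoeff_pencil h, norm_mul, norm_prod] at hc
  have h2 : ρ ^ E.natDegree ≤ ∏ i, ‖q - z i‖ := by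
    rw [← Fin.prod_const]
    refine Finset.prod_le_prod (fun _ _ => hρ.le) fun i _ => ?_
    by_contra! hlt
    rw [norm_sub_rev, ← dist_eq_norm] at hlt
    refine hcon _ (hρU hlt) ?_
    rw [← mem_roots (pencil_ne_zero h _), hz]
    exact Multiset.mem_map_of_mem _ (Finset.mem_univ_val i)
  exact absurd hc (not_lt.2 (by gcongr))

theorem card_le_countP_roots {P : ℂ[X]} (hP : P ≠ 0) {p : ℂ → Prop} [DecidablePred p]
    {F : Finset ℂ} (hF : ∀ s ∈ F, P.IsRoot s ∧ p s) : F.card ≤ P.roots.countP p := by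
  rw [Multiset.countP_eq_card_filter]
  refine Multiset.card_le_card ((Multiset.le_iff_subset F.nodup).2 fun s hs => ?_)
  rw [Multiset.mem_filter, mem_roots hP]
  exact hF s hs

/-! ### Roots of a pencil crossing the imaginary axis -/

/-- If `L z = 1` and `L' z > 0`, the solutions of `c L = 1` near `z` move to the left through
the vertical line of `z` as `c` increases through `1`. -/
theorem eventually_re_of_mul_eq_one {L : ℂ → ℂ} {z : ℂ} {ψ : ℝ} (hψ : 0 < ψ)
    (hL : HasDerivAt L ψ z) (h1 : L z = 1) :
    ∀ᶠ s in 𝓝 z, ∀ c : ℝ, 0 < c → c * L s = 1 →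
      (c < 1 → z.re < s.re) ∧ (1 < c → s.re < z.re) := by
  have hb := (hasDerivAt_iff_isLittleO.1 hL).bound (half_pos hψ)
  filter_upwards [hb] with s hs c hc hcs
  have hc' : (c : ℂ) ≠ 0 := by exact_mod_cast hc.ne'
  have hLs : L s = ((1 / c : ℝ) : ℂ) := by
    push_cast
    rw [eq_div_iff hc', mul_comm, hcs]
  have hsq : ‖L s - L z - (s - z) • (ψ : ℂ)‖ ^ 2 ≤ (ψ / 2 * ‖s - z‖) ^ 2 := by gcongr
  rw [hLs, h1, mul_pow, ← Complex.normSq_eq_norm_sq, ← Complex.normSq_eq_norm_sq,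
    Complex.normSq_apply, Complex.normSq_apply] at hsq
  simp only [smul_eq_mul, Complex.sub_re, Complex.sub_im, Complex.mul_re, Complex.mul_im,
    Complex.ofReal_re, Complex.ofReal_im, Complex.one_re, Complex.one_im, mul_zero, sub_zero,
    zero_add, zero_sub] at hsq
  -- A real number `τ` within `|ψ w| / 2` of `ψ w` has the sign of the real part `x` of `w`.
  have hτ : ∀ τ x y : ℝ, τ ≠ 0 → (τ - x * ψ) * (τ - x * ψ) + -(y * ψ) * -(y * ψ) ≤
      (ψ / 2) ^ 2 * (x * x + y * y) → 0 < τ * x := by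
    intro τ x y hτ hle
    by_contra! hx
    nlinarith [sq_pos_of_ne_zero hτ, mul_nonneg hψ.le (neg_nonneg.2 hx), sq_nonneg (ψ * x),
      sq_nonneg (ψ * y)]
  have hmain := fun hτ0 => hτ (1 / c - 1) (s.re - z.re) (s.im - z.im) hτ0 hsq
  constructor
  · intro hc1
    have : 0 < 1 / c - 1 := sub_pos.2 (by rwa [lt_div_iff₀ hc, one_mul])
    exact sub_pos.1 (pos_of_mul_pos_right (hmain this.ne') this.le)
  · intro hc1
    have : 1 / c - 1 < 0 := sub_neg.2 (by rwa [div_lt_iff₀ hc, one_mul])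
    exact sub_neg.1 (neg_of_mul_pos_right (hmain this.ne) this.le)

/-- Suppose `|N| < |E|` on the imaginary axis except at the finite set `Z`, where `N / E`
equals `1` with positive derivative, and `E` has exactly as many roots in the open right half
plane as there are points in `Z`. Then a slightly larger gain moves all roots of `E - c N` into
the open left half plane. -/
theorem eventually_no_root_pencil {E N : ℂ[X]} (h : N.degree < E.degree) {Z : Finset ℂ}
    (hlt : ∀ s : ℂ, s.re = 0 → s ∉ Z → ‖N.eval s‖ < ‖E.eval s‖)
    (hre : ∀ z ∈ Z, z.re = 0) (hne : ∀ z ∈ Z, E.eval z ≠ 0) (heq : ∀ z ∈ Z, N.eval z = E.eval z)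
    (hder : ∀ z ∈ Z, ∃ ψ : ℝ, 0 < ψ ∧ HasDerivAt (fun s => N.eval s / E.eval s) ψ z)
    (hcard : E.roots.countP (fun s => 0 < s.re) = Z.card) :
    ∀ᶠ c : ℝ in 𝓝[>] 1, ∀ s : ℂ, 0 ≤ s.re → ¬ (E - C (c : ℂ) * N).IsRoot s := by
  classical
  have hroot : ∀ {c : ℝ} {s : ℂ}, (E - C (c : ℂ) * N).IsRoot s → E.eval s = c * N.eval s := by
    intro c s hs
    simpa [IsRoot, sub_eq_zero] using hs
  have hquot : ∀ {c : ℝ} {s : ℂ}, (E - C (c : ℂ) * N).IsRoot s → E.eval s ≠ 0 →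
      c * (N.eval s / E.eval s) = 1 := by
    intro c s hs hE
    rw [← mul_div_assoc, ← hroot hs, div_self hE]
  have hcross : ∀ z ∈ Z, ∀ᶠ s in 𝓝 z, ∀ c : ℝ, 0 < c → (E - C (c : ℂ) * N).IsRoot s →
      (c < 1 → 0 < s.re) ∧ (1 < c → s.re < 0) := by
    intro z hz
    obtain ⟨ψ, hψ, hd⟩ := hder z hz
    have h1 : N.eval z / E.eval z = 1 := by rw [heq z hz, div_self (hne z hz)]
    filter_upwards [eventually_re_of_mul_eq_one hψ hd h1,
      E.continuous.continuousAt.eventually_ne (hne z hz)] with s hs hEs c hc hr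
    simpa [hre z hz] using hs c hc (hquot hr hEs)
  -- For gains below `1` the imaginary axis is free of roots, so the count is that of `E`.
  have hcount : ∀ c : ℝ, 0 ≤ c → c < 1 →
      (E - C (c : ℂ) * N).roots.countP (fun s => 0 < s.re) = Z.card := by
    intro c hc0 hc1
    rw [← hcard]
    have := countP_roots_pencil_eq h (Ω := {s : ℂ | 0 < s.re})
      (isOpen_lt continuous_const Complex.continuous_re) hc0 ?_
    · simpa using this
    intro c' hc' s hs hr
    rw [Complex.frontier_setOfPred_lt_re] at hs
    have hs : s.re = 0 := hs
    have hE := hroot hr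
    have hc'1 : c' < 1 := hc'.2.trans_lt hc1
    by_cases hsZ : s ∈ Z
    · rw [heq s hsZ] at hE
      have h2 : (c' : ℂ) = 1 := by
        have := hne s hsZ
        field_simp at hE
        exact hE.symm
      exact hc'1.ne (by exact_mod_cast h2)
    · have h1 := hlt s hs hsZ
      rw [hE, norm_mul, Complex.norm_real, Real.norm_of_nonneg hc'.1] at h1
      nlinarith [norm_nonneg (N.eval s), hc'.1]
  -- At gain `1` a root in the open half plane would be one root too many just below gain `1`.
  have hone : ∀ q : ℂ, 0 < q.re → ¬ (E - C ((1 : ℝ) : ℂ) * N).IsRoot q := by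
    intro q hq hr
    have hqZ : q ∉ Z := fun hqZ => hq.ne' (hre q hqZ)
    obtain ⟨U, hU, hdisj⟩ := (insert q Z).finite_toSet.t2_separation
    have hnear : ∀ e ∈ insert q Z, ∀ᶠ c : ℝ in 𝓝[<] 1,
        ∃ s ∈ U e, (E - C (c : ℂ) * N).IsRoot s ∧ 0 < s.re := by
      intro e he
      rw [Finset.mem_insert] at he
      rcases he with rfl | he
      · have := eventually_exists_root_pencil h hr (U := U e ∩ {s | 0 < s.re})
          (inter_mem ((hU e).2.mem_nhds (hU e).1)
            ((isOpen_lt continuous_const Complex.continuous_re).mem_nhds hq))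
        filter_upwards [this.filter_mono nhdsWithin_le_nhds] with c ⟨s, hs, hsr⟩
        exact ⟨s, hs.1, hsr, hs.2⟩
      · have hre1 : (E - C ((1 : ℝ) : ℂ) * N).IsRoot e := by simp [IsRoot, heq e he]
        have := eventually_exists_root_pencil h hre1
          (inter_mem ((hU e).2.mem_nhds (hU e).1) (hcross e he))
        filter_upwards [this.filter_mono nhdsWithin_le_nhds, self_mem_nhdsWithin,
          (lt_mem_nhds one_pos).filter_mono nhdsWithin_le_nhds] with c ⟨s, hs, hsr⟩ hc1 hc0
        exact ⟨s, hs.1, hsr, (hs.2 c hc0 hsr).1 hc1⟩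
    rw [← Finset.eventually_all] at hnear
    obtain ⟨c, hc, hc0, hc1⟩ := (hnear.and (((lt_mem_nhds one_pos).filter_mono
      nhdsWithin_le_nhds).and self_mem_nhdsWithin)).exists
    choose! f hfU hfr hfre using hc
    have hinj : Set.InjOn f (insert q Z : Finset ℂ) := by
      intro x hx y hy hxy
      by_contra hne'
      exact Set.disjoint_left.1 (hdisj hx hy hne') (hfU x hx) (hxy ▸ hfU y hy)
    have h1 := card_le_countP_roots (pencil_ne_zero h (c : ℂ)) (p := fun s => 0 < s.re)
      (F := (insert q Z).image f) (by
        intro s hs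
        obtain ⟨e, he, rfl⟩ := Finset.mem_image.1 hs
        exact ⟨hfr e he, hfre e he⟩)
    rw [Finset.card_image_of_injOn hinj, Finset.card_insert_of_notMem hqZ,
      hcount c hc0.le hc1] at h1
    omega
  -- The roots stay bounded, so it remains to exclude them near each point as the gain decreases
  -- to `1`.
  obtain ⟨R, hR⟩ := exists_norm_root_le h 2
  have hloc : ∀ s ∈ Metric.closedBall (0 : ℂ) R, ∀ᶠ x : ℝ × ℂ in 𝓝 1 ×ˢ 𝓝 s,
      1 < x.1 → 0 ≤ x.2.re → ¬ (E - C (x.1 : ℂ) * N).IsRoot x.2 := by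
    intro s _
    rcases lt_or_ge s.re 0 with hs | hs
    · filter_upwards [(Complex.continuous_re.continuousAt.eventually
        (gt_mem_nhds hs)).prod_inr (𝓝 (1 : ℝ))] with x hx _ hx'
      exact absurd hx' (not_le.2 hx)
    by_cases hr : (E - C ((1 : ℝ) : ℂ) * N).IsRoot s
    · have hs0 : s.re = 0 := le_antisymm (not_lt.1 fun h' => hone s h' hr) hs
      have hsZ : s ∈ Z := by
        by_contra hsZ
        have := hlt s hs0 hsZ
        rw [hroot hr] at this
        simp at this
      filter_upwards [(hcross s hsZ).prod_inr (𝓝 (1 : ℝ))] with x hx hx1 hx0 hxr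
      exact absurd ((hx x.1 (one_pos.trans hx1) hxr).2 hx1) (not_lt.2 hx0)
    · rw [← nhds_prod_eq]
      have hcont : ContinuousAt (fun x : ℝ × ℂ => (E - C (x.1 : ℂ) * N).eval x.2) (1, s) := by
        simp only [eval_sub, eval_mul, eval_C]
        have := E.continuous
        have := N.continuous
        fun_prop
      filter_upwards [hcont.eventually_ne hr] with x hx _ _ using hx
  have hall := (isCompact_closedBall (0 : ℂ) R).eventually_forall_of_forall_eventually
    (x₀ := (1 : ℝ)) (P := fun c s => 1 < c → 0 ≤ s.re → ¬ (E - C (c : ℂ) * N).IsRoot s)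
    (by simpa only [← nhds_prod_eq] using hloc)
  filter_upwards [hall.filter_mono nhdsWithin_le_nhds, self_mem_nhdsWithin,
    (gt_mem_nhds one_lt_two).filter_mono nhdsWithin_le_nhds] with c hc hc1 hc2 s hs hr
  refine hc s ?_ hc1 hs hr
  rw [mem_closedBall_zero_iff]
  refine hR c ?_ s hr
  rw [Complex.norm_real, Real.norm_of_nonneg (one_pos.trans hc1).le]
  exact hc2.le

/-! ### Values of transfer functions -/

theorem tf_eq (g : RatFunc ℝ) (s : ℂ) : tf g s = aeval s g.num / aeval s g.denom := rfl

theorem tf_conj (g : RatFunc ℝ) (s : ℂ) : tf g (conj s) = conj (tf g s) := by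
  simp only [tf_eq, aeval_conj, map_div₀]

theorem isPole_conj {g : RatFunc ℝ} {s : ℂ} : IsPole g (conj s) ↔ IsPole g s := by
  simp [IsPole, aeval_conj]

theorem aeval_ofReal_eq (p : ℝ[X]) (x : ℝ) : aeval (x : ℂ) p = ((p.eval x : ℝ) : ℂ) := by
  simpa using aeval_algebraMap_apply ℂ x p

theorem tf_ofReal (g : RatFunc ℝ) (x : ℝ) :
    tf g x = ((g.num.eval x / g.denom.eval x : ℝ) : ℂ) := by
  simp only [tf_eq, aeval_ofReal_eq, Complex.ofReal_div]

theorem analyticAt_tf {g : RatFunc ℝ} {s : ℂ} (hs : ¬ IsPole g s) : AnalyticAt ℂ (tf g) s :=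
  (analyticAt_id.aeval_polynomial g.num).div (analyticAt_id.aeval_polynomial g.denom) hs

theorem IsRLinf.not_isPole {g : RatFunc ℝ} (hg : IsRLinf g) {s : ℂ} (hs : s.re = 0) :
    ¬ IsPole g s := by
  have : s = s.im * Complex.I := by
    apply Complex.ext <;> simp [hs]
  rw [this]
  exact hg.1 _

theorem tf_eq_freq (g : RatFunc ℝ) {s : ℂ} (hs : s.re = 0) : tf g s = freq g s.im := by
  have : s = s.im * Complex.I := by
    apply Complex.ext <;> simp [hs]
  rw [freq, ← this]

theorem freq_neg (g : RatFunc ℝ) (ω : ℝ) : freq g (-ω) = conj (freq g ω) := by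
  rw [freq, freq, ← tf_conj]
  simp

theorem IsRHinf.not_isPole {δ : RatFunc ℝ} (hδ : IsRHinf δ) {s : ℂ} (hs : 0 ≤ s.re) :
    ¬ IsPole δ s := fun h => absurd (hδ.2 s h) (not_lt.2 hs)

/-- The bound extends to the imaginary axis by continuity. -/
theorem norm_tf_le_of_hinfNorm_le {δ : RatFunc ℝ} (hδ : IsRHinf δ) {M : ℝ} (hM0 : 0 ≤ M)
    (hM : hinfNorm δ ≤ ENNReal.ofReal M) {s : ℂ} (hs : 0 ≤ s.re) : ‖tf δ s‖ ≤ M := by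
  have hopen : ∀ s : ℂ, 0 < s.re → ‖tf δ s‖ ≤ M := by
    intro s hs
    have h1 : ‖tf δ s‖ₑ ≤ ENNReal.ofReal M := (le_iSup₂ (f := fun (s : ℂ) (_ : 0 < s.re) =>
      ‖tf δ s‖ₑ) s hs).trans hM
    rwa [← ofReal_norm, ENNReal.ofReal_le_ofReal_iff hM0] at h1
  have hcont : Tendsto (fun x : ℝ => ‖tf δ (s + x)‖) (𝓝[>] 0) (𝓝 ‖tf δ s‖) := by
    have h1 : ContinuousAt (tf δ) (s + (0 : ℝ)) := by
      rw [Complex.ofReal_zero, add_zero]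
      exact (analyticAt_tf (hδ.not_isPole hs)).continuousAt
    have h2 : ContinuousAt (fun x : ℝ => ‖tf δ (s + x)‖) 0 :=
      (ContinuousAt.comp (f := fun x : ℝ => s + (x : ℂ)) h1 (by fun_prop)).norm
    simpa using h2.tendsto.mono_left nhdsWithin_le_nhds
  refine le_of_tendsto hcont ?_
  filter_upwards [self_mem_nhdsWithin] with x hx
  refine hopen _ ?_
  have : 0 < x := hx
  simpa using by linarith

theorem tendsto_tf_cobounded {g : RatFunc ℝ} (hg : StrictlyProper g) :
    Tendsto (tf g) (cobounded ℂ) (𝓝 0) := by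
  have h : (g.num.map (algebraMap ℝ ℂ)).degree < (g.denom.map (algebraMap ℝ ℂ)).degree := by
    rwa [degree_map, degree_map]
  have := (isLittleO_cobounded_of_degree_lt h).tendsto_div_nhds_zero
  simp only [eval_map_algebraMap] at this
  exact this

/-- A rational function that is bounded on the right half plane is proper. -/
theorem degree_num_le_of_norm_tf_le {δ : RatFunc ℝ} {M : ℝ}
    (hM : ∀ x : ℝ, 0 ≤ x → ‖tf δ x‖ ≤ M) : δ.num.degree ≤ δ.denom.degree := by
  by_contra! hlt
  have h := abs_div_tendsto_atTop_atTop_of_degree_gt _ _ hlt δ.denom_ne_zero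
  obtain ⟨x, hx, hx0⟩ := ((h.eventually_gt_atTop M).and (eventually_ge_atTop 0)).exists
  have := hM x hx0
  rw [tf_ofReal, Complex.norm_real, Real.norm_eq_abs] at this
  linarith

/-! ### Stabilising perturbations and the closed-loop pencil -/

/-- The open-loop polynomial `b d` of the plant `n / d` and the perturbation `a / b`. -/
noncomputable def loopDen (g δ : RatFunc ℝ) : ℝ[X] := δ.denom * g.denom

/-- The polynomial `a n` of the plant `n / d` and the perturbation `a / b`; the closed loop has
characteristic polynomial `b d - a n`. -/
noncomputable def loopNum (g δ : RatFunc ℝ) : ℝ[X] := δ.num * g.num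

theorem degree_mul_lt_degree_mul {a b n d : ℝ[X]} (hb : b ≠ 0) (hab : a.degree ≤ b.degree)
    (hnd : n.degree < d.degree) : (a * n).degree < (b * d).degree := by
  have hd : d ≠ 0 := by rintro rfl; simp at hnd
  rcases eq_or_ne (a * n) 0 with h0 | h0
  · rw [h0, degree_zero, bot_lt_iff_ne_bot, Ne, degree_eq_bot]
    exact mul_ne_zero hb hd
  have ha := left_ne_zero_of_mul h0
  have hn := right_ne_zero_of_mul h0
  refine degree_lt_degree ?_
  rw [natDegree_mul ha hn, natDegree_mul hb hd]
  exact add_lt_add_of_le_of_lt (natDegree_le_natDegree hab) (natDegree_lt_natDegree hn hnd)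

theorem degree_loopNum_lt {g δ : RatFunc ℝ} (hg : StrictlyProper g)
    (hδ : δ.num.degree ≤ δ.denom.degree) : (loopNum g δ).degree < (loopDen g δ).degree :=
  degree_mul_lt_degree_mul δ.denom_ne_zero hδ hg

/-- Internal stability: the characteristic polynomial has no root in the closed right half
plane. The no-cancellation condition takes care of the roots that are poles of the plant. -/
theorem aeval_loop_ne_zero {g δ : RatFunc ℝ} (hg : IsRLinf g) (hδ : δ ∈ stabilizing g) {s : ℂ}
    (hs : 0 ≤ s.re) : aeval s (loopDen g δ - loopNum g δ) ≠ 0 := by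
  intro h
  obtain ⟨hR, hroot, hcanc⟩ := hδ
  have hb : aeval s δ.denom ≠ 0 := hR.not_isPole hs
  simp only [loopDen, loopNum, map_sub, map_mul, sub_eq_zero] at h
  by_cases hd : aeval s g.denom = 0
  · have hs' : 0 < s.re := lt_of_le_of_ne hs fun h0 => hg.not_isPole h0.symm hd
    rw [hd, mul_zero, eq_comm, mul_eq_zero] at h
    rcases h with h | h
    · exact hcanc s (by rw [tf_eq, h, zero_div]) hs' hd
    · obtain ⟨u, v, huv⟩ := g.isCoprime_num_denom
      have := congrArg (aeval s) huv
      simp [h, hd] at this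
  · have : tf δ s * tf g s = 1 := by
      rw [tf_eq, tf_eq, div_mul_div_comm, ← h, div_self (mul_ne_zero hb hd)]
    exact absurd (hroot s this) (not_lt.2 hs)

/-- If `δ` stabilises `g`, then on the boundary of every part `Ω` of the right half plane that
contains a pole of `g` there is a point where `t δ g = 1` for some `t ∈ [0, 1]`: otherwise the
homotopy from `0` to `δ` could not remove the unstable closed-loop root from `Ω`. -/
theorem exists_frontier_mul_eq_one {g δ : RatFunc ℝ} (hg : IsRLinf g) (hp : StrictlyProper g)
    (hδ : δ ∈ stabilizing g) (hfin : hinfNorm δ ≠ ⊤) {Ω : Set ℂ} (hΩ : IsOpen Ω)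
    (hΩre : ∀ s ∈ Ω, 0 < s.re) {p : ℂ} (hpΩ : p ∈ Ω) (hpole : IsPole g p)
    (hfr : ∀ s ∈ frontier Ω, ¬ IsPole g s) :
    ∃ t ∈ Set.Icc (0 : ℝ) 1, ∃ s ∈ frontier Ω, 0 ≤ s.re ∧ t * tf δ s * tf g s = 1 := by
  by_contra! hcon
  have hbd : ∀ s : ℂ, 0 ≤ s.re → ‖tf δ s‖ ≤ (hinfNorm δ).toReal := fun s hs =>
    norm_tf_le_of_hinfNorm_le hδ.1 ENNReal.toReal_nonneg (ENNReal.ofReal_toReal hfin).ge hs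
  have hdeg := degree_loopNum_lt hp (degree_num_le_of_norm_tf_le fun x hx => hbd x (by simpa))
  have hdeg' : ((loopNum g δ).map (algebraMap ℝ ℂ)).degree <
      ((loopDen g δ).map (algebraMap ℝ ℂ)).degree := by rwa [degree_map, degree_map]
  have hroot0 : ((loopDen g δ).map (algebraMap ℝ ℂ)).IsRoot p := by
    have : aeval p g.denom = 0 := hpole
    simp [IsRoot, eval_map_algebraMap, loopDen, this]
  have hfree : ∀ t ∈ Set.Icc (0 : ℝ) 1, ∀ s ∈ frontier Ω,
      ¬ ((loopDen g δ).map (algebraMap ℝ ℂ) -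
        C (t : ℂ) * (loopNum g δ).map (algebraMap ℝ ℂ)).IsRoot s := by
    intro t ht s hs hroot
    have hre : 0 ≤ s.re := by
      have : closure Ω ⊆ {s : ℂ | 0 ≤ s.re} := closure_minimal (fun s hs => (hΩre s hs).le)
        (isClosed_le continuous_const Complex.continuous_re)
      exact this (frontier_subset_closure hs)
    refine hcon t ht s hs hre ?_
    have hb : aeval s δ.denom ≠ 0 := hδ.1.not_isPole hre
    have hd : aeval s g.denom ≠ 0 := hfr s hs
    simp only [IsRoot, eval_sub, eval_mul, eval_C, eval_map_algebraMap, loopDen, loopNum,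
      map_mul, sub_eq_zero] at hroot
    rw [tf_eq, tf_eq, mul_assoc, div_mul_div_comm, ← mul_div_assoc, ← hroot,
      div_self (mul_ne_zero hb hd)]
  obtain ⟨s, hs, hroot⟩ := exists_root_mem_of_pencil hdeg' hΩ hfree hpΩ hroot0
  refine aeval_loop_ne_zero hg hδ (hΩre s hs).le ?_
  rw [← eval_map_algebraMap, Polynomial.map_sub]
  exact hroot

theorem frontier_re_pos : frontier {s : ℂ | 0 < s.re} = {s | s.re = 0} :=
  Complex.frontier_setOfPred_lt_re 0

theorem isOpen_re_pos : IsOpen {s : ℂ | 0 < s.re} :=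
  isOpen_lt continuous_const Complex.continuous_re

theorem exists_isPole_re_pos {g : RatFunc ℝ} (hg : g ∈ classG) : ∃ p, IsPole g p ∧ 0 < p.re := by
  obtain ⟨h1, -, h3⟩ := hg
  simp only [IsStable, not_forall, not_lt] at h3
  obtain ⟨p, hp, hre⟩ := h3
  exact ⟨p, hp, lt_of_le_of_ne hre fun h => h1.not_isPole h.symm hp⟩

/-- The small gain bound: on the imaginary axis `|t δ g| ≤ ‖δ‖ ‖g‖`. -/
theorem inv_linfNorm_le_hinfNorm {g δ : RatFunc ℝ} (hg : g ∈ classG) (hδ : δ ∈ stabilizing g) :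
    (linfNorm g)⁻¹ ≤ hinfNorm δ := by
  by_contra! hlt
  have hfin : hinfNorm δ ≠ ⊤ := hlt.ne_top
  obtain ⟨p, hp, hre⟩ := exists_isPole_re_pos hg
  obtain ⟨t, ht, s, hs, -, h1⟩ := exists_frontier_mul_eq_one hg.1 hg.2.1 hδ hfin isOpen_re_pos
    (fun s hs => hs) hre hp (fun s hs => hg.1.not_isPole (by rwa [frontier_re_pos] at hs))
  rw [frontier_re_pos] at hs
  have hs : s.re = 0 := hs
  have h2 : ‖tf δ s‖ₑ ≤ hinfNorm δ := by
    rw [← ofReal_norm]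
    refine ENNReal.ofReal_le_of_le_toReal ?_
    exact norm_tf_le_of_hinfNorm_le hδ.1 ENNReal.toReal_nonneg
      (ENNReal.ofReal_toReal hfin).ge hs.ge
  have h3 : ‖tf g s‖ₑ ≤ linfNorm g := by
    rw [tf_eq_freq g hs]
    exact le_iSup (fun ω => ‖freq g ω‖ₑ) s.im
  have h4 : ‖(t : ℂ)‖ₑ ≤ 1 := by
    rw [← ofReal_norm, Complex.norm_real, Real.norm_of_nonneg ht.1]
    exact ENNReal.ofReal_le_one.2 ht.2
  have h5 : (1 : ℝ≥0∞) ≤ hinfNorm δ * linfNorm g := by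
    calc (1 : ℝ≥0∞) = ‖(t : ℂ) * tf δ s * tf g s‖ₑ := by rw [h1, enorm_one]
      _ = ‖(t : ℂ)‖ₑ * ‖tf δ s‖ₑ * ‖tf g s‖ₑ := by rw [enorm_mul, enorm_mul]
      _ ≤ 1 * hinfNorm δ * linfNorm g := by gcongr
      _ = _ := by rw [one_mul]
  exact absurd h5 (not_le.2 (ENNReal.mul_lt_of_lt_div (by rwa [one_div])))

theorem inv_linfNorm_le_rir {g : RatFunc ℝ} (hg : g ∈ classG) : (linfNorm g)⁻¹ ≤ rir g :=
  le_iInf₂ fun _ hδ => inv_linfNorm_le_hinfNorm hg hδ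

/-! ### The phase derivative at a peak of the gain -/

theorem hasDerivAt_tf {g : RatFunc ℝ} {s : ℂ} (hs : ¬ IsPole g s) :
    HasDerivAt (tf g) (deriv (tf g) s) s :=
  (analyticAt_tf hs).differentiableAt.hasDerivAt

/-- At a peak of the gain the logarithmic derivative `g' / g` along the imaginary axis is real and
equals the derivative of the phase. -/
theorem deriv_tf_eq_deriv_phase_mul {g : RatFunc ℝ} (hg : IsRLinf g) {θ : ℝ → ℝ}
    (hθ : IsPhase g θ) {ω₀ : ℝ} (h0 : freq g ω₀ ≠ 0)
    (hmax : ∀ ω, ‖freq g ω‖ ≤ ‖freq g ω₀‖) :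
    deriv (tf g) (ω₀ * Complex.I) = deriv θ ω₀ * freq g ω₀ := by
  have hd : HasDerivAt (freq g) (deriv (tf g) (ω₀ * Complex.I) * Complex.I) ω₀ := by
    have h1 : HasDerivAt (fun ω : ℝ => (ω : ℂ) * Complex.I) Complex.I ω₀ := by
      simpa using (Complex.ofRealCLM.hasDerivAt (x := ω₀)).mul_const Complex.I
    exact HasDerivAt.comp (h₂ := tf g) (h := fun ω : ℝ => (ω : ℂ) * Complex.I) ω₀
      (hasDerivAt_tf (hg.1 ω₀)) h1
  set κ := deriv (tf g) (ω₀ * Complex.I) * Complex.I / freq g ω₀ with hκ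
  have hq : HasDerivAt (fun ω => freq g ω / freq g ω₀) κ ω₀ := hd.div_const _
  -- The real part of this logarithm has a maximum at `ω₀`; the imaginary part is `θ - θ ω₀`.
  have hlog : HasDerivAt (fun ω => Complex.log (freq g ω / freq g ω₀)) κ ω₀ := by
    have := hq.clog_real (by rw [div_self h0]; exact Complex.one_mem_slitPlane)
    simpa [div_self h0] using this
  have hre : HasDerivAt (fun ω => (Complex.log (freq g ω / freq g ω₀)).re) κ.re ω₀ := by
    exact Complex.reCLM.hasFDerivAt.comp_hasDerivAt ω₀ hlog
  have him : HasDerivAt (fun ω => (Complex.log (freq g ω / freq g ω₀)).im) κ.im ω₀ := by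
    exact Complex.imCLM.hasFDerivAt.comp_hasDerivAt ω₀ hlog
  have hκre : κ.re = 0 := by
    refine IsLocalMax.hasDerivAt_eq_zero (Eventually.of_forall fun ω => ?_) hre
    rw [Complex.log_re, Complex.log_re, div_self h0, norm_one, Real.log_one]
    refine Real.log_nonpos (norm_nonneg _) ?_
    rw [norm_div]
    exact div_le_one_of_le₀ (hmax ω) (norm_nonneg _)
  have hopen : IsOpen {ω | freq g ω ≠ 0} := by
    have : Continuous (freq g) := continuous_iff_continuousAt.2 fun ω =>
      ContinuousAt.comp (g := tf g) (f := fun ω : ℝ => (ω : ℂ) * Complex.I)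
        (analyticAt_tf (hg.1 ω)).continuousAt (by fun_prop)
    exact isOpen_ne_fun this continuous_const
  have hcont : ContinuousAt θ ω₀ := hθ.1.continuousAt (hopen.mem_nhds h0)
  have hclose : ∀ᶠ ω in 𝓝 ω₀, |θ ω - θ ω₀| < Real.pi := by
    have : Tendsto (fun ω => |θ ω - θ ω₀|) (𝓝 ω₀) (𝓝 0) := by
      simpa using (hcont.tendsto.sub_const (θ ω₀)).abs
    exact this.eventually (gt_mem_nhds Real.pi_pos)
  have hθd : HasDerivAt θ κ.im ω₀ := by
    refine (him.add_const (θ ω₀)).congr_of_eventuallyEq ?_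
    filter_upwards [hclose, hopen.mem_nhds h0] with ω hω hne
    have hn : ∀ {ω}, freq g ω ≠ 0 → ((‖freq g ω‖ : ℝ) : ℂ) ≠ 0 := fun h => by
      exact_mod_cast (norm_pos_iff.2 h).ne'
    have h1 : freq g ω / freq g ω₀ =
        Complex.exp (Real.log (‖freq g ω‖ / ‖freq g ω₀‖) + (θ ω - θ ω₀ : ℝ) * Complex.I) := by
      rw [Complex.exp_add, ← Complex.ofReal_exp, Real.exp_log
        (div_pos (norm_pos_iff.2 hne) (norm_pos_iff.2 h0))]
      conv_lhs => rw [hθ.2 ω, hθ.2 ω₀]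
      push_cast
      rw [sub_mul, Complex.exp_sub, mul_div_mul_comm]
    rw [h1, Complex.log_exp]
    · simp
    · simpa using (abs_lt.1 hω).1
    · simpa using (abs_lt.1 hω).2.le
  rw [hθd.deriv]
  have h2 : κ = κ.im * Complex.I := by
    apply Complex.ext <;> simp [hκre]
  have h3 : deriv (tf g) (ω₀ * Complex.I) * Complex.I = κ * freq g ω₀ := by
    rw [hκ, div_mul_cancel₀ _ h0]
  rw [h2] at h3
  have h4 : deriv (tf g) (ω₀ * Complex.I) * Complex.I =
      (κ.im * freq g ω₀) * Complex.I := by rw [h3]; ring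
  exact mul_right_cancel₀ Complex.I_ne_zero h4

/-! ### Plants with one unstable pole -/

theorem map_denom_ne_zero (g : RatFunc ℝ) : g.denom.map (algebraMap ℝ ℂ) ≠ 0 :=
  (Polynomial.map_ne_zero_iff (algebraMap ℝ ℂ).injective).2 g.denom_ne_zero

theorem isRoot_map_denom {g : RatFunc ℝ} {s : ℂ} :
    (g.denom.map (algebraMap ℝ ℂ)).IsRoot s ↔ IsPole g s := by
  rw [IsRoot, eval_map_algebraMap, IsPole]

/-- A single unstable pole is real and simple. -/
theorem exists_denom_eq_of_numUnstablePoles_eq_one {g : RatFunc ℝ} (hg : IsRLinf g)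
    (h1 : numUnstablePoles g = 1) :
    ∃ p : ℝ, 0 < p ∧ ∃ d : ℝ[X], g.denom = (X - C p) * d ∧ ∀ x : ℝ, 0 ≤ x → d.eval x ≠ 0 := by
  obtain ⟨p, hp, hre⟩ := Multiset.countP_pos.1 (h1 ▸ Nat.one_pos)
  have hp : IsPole g p := isRoot_map_denom.1 (isRoot_of_mem_roots hp)
  have hconj : conj p = p := by
    by_contra hne
    have := card_le_countP_roots (map_denom_ne_zero g) (p := fun s : ℂ => 0 < s.re)
      (F := {conj p, p}) (by
        intro s hs
        rw [Finset.mem_insert, Finset.mem_singleton] at hs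
        rcases hs with rfl | rfl
        · exact ⟨isRoot_map_denom.2 (isPole_conj.2 hp), by simpa using hre⟩
        · exact ⟨isRoot_map_denom.2 hp, hre⟩)
    rw [Finset.card_pair hne] at this
    change 2 ≤ numUnstablePoles g at this
    omega
  obtain ⟨r, rfl⟩ := Complex.conj_eq_iff_real.1 hconj
  have hr : 0 < r := by simpa using hre
  have hroot : g.denom.IsRoot r := by
    rw [IsPole, aeval_ofReal_eq] at hp
    exact_mod_cast hp
  obtain ⟨d, hd⟩ := dvd_iff_isRoot.2 hroot
  refine ⟨r, hr, d, hd, fun x hx hdx => ?_⟩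
  have hne : (X - C r) * d ≠ 0 := hd ▸ g.denom_ne_zero
  have hx0 : 0 < x := by
    refine lt_of_le_of_ne hx fun h0 => hg.not_isPole (s := (x : ℂ)) (by simp [← h0]) ?_
    rw [IsPole, hd, map_mul, aeval_ofReal_eq d, hdx]
    simp
  rw [numUnstablePoles, hd, aroots_mul hne, Multiset.countP_add, aroots_X_sub_C] at h1
  have h2 : 0 < Multiset.countP (fun s : ℂ => 0 < s.re) (d.aroots ℂ) := by
    refine Multiset.countP_pos.2 ⟨x, ?_, by simpa⟩
    rw [mem_aroots, aeval_ofReal_eq, hdx]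
    exact ⟨right_ne_zero_of_mul hne, by simp⟩
  have h3 : Multiset.countP (fun s : ℂ => 0 < s.re) {algebraMap ℝ ℂ r} = 1 := by
    rw [← Multiset.cons_zero, Multiset.countP_cons_of_pos _ (by simpa)]
    simp
  omega

/-- A monic real polynomial without roots in `[0, ∞)` is positive there. -/
theorem eval_pos_of_monic_of_ne_zero {P : ℝ[X]} (hP : P.Monic)
    (h : ∀ x, 0 ≤ x → P.eval x ≠ 0) {x : ℝ} (hx : 0 ≤ x) : 0 < P.eval x := by
  by_contra! hle
  have hev : ∀ᶠ y in atTop, 0 < P.eval y := by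
    rcases Nat.eq_zero_or_pos P.natDegree with h0 | h0
    · simp [(Monic.natDegree_eq_zero hP).1 h0]
    · exact (tendsto_atTop_of_leadingCoeff_nonneg P (natDegree_pos_iff_degree_pos.1 h0)
        (by rw [hP.leadingCoeff]; exact zero_le_one)).eventually_gt_atTop 0
  obtain ⟨y, hy, hxy⟩ := (hev.and (eventually_ge_atTop x)).exists
  obtain ⟨z, hz, hz0⟩ := intermediate_value_Icc hxy P.continuous.continuousOn ⟨hle, hy.le⟩
  exact h z (hx.trans hz.1) hz0

/-- With a single unstable pole `p`, the closed-loop polynomial keeps its sign on `[0, ∞)` while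
the open-loop one changes it at `p`; hence `δ g > 1` on `[0, p)` for every stabilising `δ`. -/
theorem one_lt_norm_mul_of_stabilizing {g δ : RatFunc ℝ} (hg : IsRLinf g)
    (hp : StrictlyProper g) (hδ : δ ∈ stabilizing g) (hfin : hinfNorm δ ≠ ⊤) {p : ℝ} {d : ℝ[X]}
    (hd : g.denom = (X - C p) * d) (hd0 : ∀ x : ℝ, 0 ≤ x → d.eval x ≠ 0) {x : ℝ} (hx : 0 ≤ x)
    (hxp : x < p) : 1 < ‖tf δ x‖ * ‖tf g x‖ := by
  have hbd : ∀ s : ℂ, 0 ≤ s.re → ‖tf δ s‖ ≤ (hinfNorm δ).toReal := fun s hs =>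
    norm_tf_le_of_hinfNorm_le hδ.1 ENNReal.toReal_nonneg (ENNReal.ofReal_toReal hfin).ge hs
  have hdeg := degree_loopNum_lt hp (degree_num_le_of_norm_tf_le fun x hx => hbd x (by simpa))
  have hmonic : ((loopDen g δ - loopNum g δ) * δ.denom * d).Monic := by
    refine Monic.mul (Monic.mul ?_ δ.monic_denom) ?_
    · exact (δ.monic_denom.mul g.monic_denom).sub_of_left hdeg
    · exact (monic_X_sub_C p).of_mul_monic_left (hd ▸ g.monic_denom)
  have hb0 : ∀ y : ℝ, 0 ≤ y → δ.denom.eval y ≠ 0 := by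
    intro y hy h
    refine hδ.1.not_isPole (s := (y : ℂ)) (by simpa) ?_
    rw [IsPole, aeval_ofReal_eq, h, Complex.ofReal_zero]
  have hpos := eval_pos_of_monic_of_ne_zero hmonic (fun y hy h => by
    rw [eval_mul, eval_mul, mul_eq_zero, mul_eq_zero] at h
    rcases h with (h | h) | h
    · refine aeval_loop_ne_zero hg hδ (s := (y : ℂ)) (by simpa) ?_
      rw [aeval_ofReal_eq, h, Complex.ofReal_zero]
    · exact hb0 y hy h
    · exact hd0 y hy h) hx
  have hdx : g.denom.eval x = (x - p) * d.eval x := by rw [hd]; simp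
  simp only [loopDen, loopNum, eval_mul, eval_sub] at hpos
  have hg0 : g.denom.eval x ≠ 0 := by
    rw [hdx]
    exact mul_ne_zero (sub_neg.2 hxp).ne (hd0 x hx)
  have h1 : (δ.denom.eval x * g.denom.eval x - δ.num.eval x * g.num.eval x) *
      (δ.denom.eval x * g.denom.eval x) < 0 := by
    have := mul_neg_of_neg_of_pos (sub_neg.2 hxp) hpos
    calc _ = (x - p) * ((δ.denom.eval x * g.denom.eval x - δ.num.eval x * g.num.eval x) *
          δ.denom.eval x * d.eval x) := by rw [hdx]; ring
      _ < 0 := this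
  have h2 : 1 < (δ.num.eval x / δ.denom.eval x) * (g.num.eval x / g.denom.eval x) := by
    rw [div_mul_div_comm]
    set u := δ.denom.eval x * g.denom.eval x with hu
    have hu0 : u ≠ 0 := mul_ne_zero (hb0 x hx) hg0
    have h3 : 0 < u ^ 2 := by positivity
    rw [← sub_neg, one_sub_div hu0, ← neg_pos]
    have h4 : (u - δ.num.eval x * g.num.eval x) / u =
        (u - δ.num.eval x * g.num.eval x) * u / u ^ 2 := by
      field_simp
    rw [h4, neg_pos]
    exact div_neg_of_neg_of_pos h1 h3
  rw [tf_ofReal, tf_ofReal, Complex.norm_real, Complex.norm_real, ← norm_mul]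
  exact h2.trans_le (le_abs_self _)

theorem inv_enorm_tf_le_rir {g : RatFunc ℝ} (hg : IsRLinf g) (hp : StrictlyProper g) {p : ℝ}
    {d : ℝ[X]} (hd : g.denom = (X - C p) * d) (hd0 : ∀ x : ℝ, 0 ≤ x → d.eval x ≠ 0) {x : ℝ}
    (hx : 0 ≤ x) (hxp : x < p) : ‖tf g x‖ₑ⁻¹ ≤ rir g := by
  refine le_iInf₂ fun δ hδ => ?_
  rcases eq_or_ne (hinfNorm δ) ⊤ with h | hfin
  · rw [h]; exact le_top
  have h1 := one_lt_norm_mul_of_stabilizing hg hp hδ hfin hd hd0 hx hxp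
  rw [← one_div]
  refine ENNReal.div_le_of_le_mul ?_
  have h2 : ‖tf δ x‖ₑ ≤ hinfNorm δ := by
    rw [← ofReal_norm]
    exact ENNReal.ofReal_le_of_le_toReal (norm_tf_le_of_hinfNorm_le hδ.1
      ENNReal.toReal_nonneg (ENNReal.ofReal_toReal hfin).ge (by simpa))
  calc (1 : ℝ≥0∞) = ENNReal.ofReal 1 := by simp
    _ ≤ ENNReal.ofReal (‖tf δ x‖ * ‖tf g x‖) := ENNReal.ofReal_le_ofReal h1.le
    _ = ‖tf δ x‖ₑ * ‖tf g x‖ₑ := by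
      rw [ENNReal.ofReal_mul (norm_nonneg _), ofReal_norm, ofReal_norm]
    _ ≤ _ := by gcongr

theorem freq_zero (g : RatFunc ℝ) : freq g 0 = tf g (0 : ℝ) := by simp [freq]

/-- A peak at a positive frequency exceeds the gain at `0`, which bounds the radius of a plant with
a single unstable pole. -/
theorem inv_linfNorm_lt_rir_of_classGnSharp_one {g : RatFunc ℝ} (hg : g ∈ classGnSharp 1) :
    (linfNorm g)⁻¹ < rir g := by
  obtain ⟨⟨⟨hRL, hsp, -⟩, h1, -⟩, ωp, hωp, hpk, hlt⟩ := hg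
  obtain ⟨p, hp, d, hd, hd0⟩ := exists_denom_eq_of_numUnstablePoles_eq_one hRL h1
  refine lt_of_lt_of_le ?_ (inv_enorm_tf_le_rir hRL hsp hd hd0 le_rfl hp)
  rw [hpk, ENNReal.inv_lt_inv, ← freq_zero, ← not_le, enorm_le_iff_norm_le, not_le]
  exact hlt 0 hωp.ne (neg_neg_of_pos hωp).ne'

theorem IsUniquePeak.norm_le {g : RatFunc ℝ} {ωp : ℝ} (h : IsUniquePeak g ωp) (ω : ℝ) :
    ‖freq g ω‖ ≤ ‖freq g ωp‖ := by
  by_cases h1 : ω = ωp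
  · rw [h1]
  by_cases h2 : ω = -ωp
  · rw [h2, freq_neg, Complex.norm_conj]
  exact (h.2 ω h1 h2).le

theorem IsUniquePeak.freq_ne_zero {g : RatFunc ℝ} {ωp : ℝ} (h : IsUniquePeak g ωp) :
    freq g ωp ≠ 0 := by
  have h1 := h.2 (|ωp| + 1) (by intro h'; linarith [le_abs_self ωp])
    (by intro h'; linarith [neg_abs_le ωp, neg_le_abs ωp])
  exact norm_pos_iff.1 ((norm_nonneg _).trans_lt h1)

/-- If the small gain bound is attained, then `|g x| ≥ |g 0|` for small `x ≥ 0`, and the derivative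
of `|g|` along the real axis at `0` is `θ' |g 0|`. -/
theorem deriv_phase_nonneg_of_rir_eq {g : RatFunc ℝ} (hg : g ∈ classGnZero 1) {θ : ℝ → ℝ}
    (hθ : IsPhase g θ) (hr : rir g = (linfNorm g)⁻¹) : 0 ≤ deriv θ 0 := by
  obtain ⟨⟨⟨hRL, hsp, -⟩, h1, -⟩, hpk⟩ := hg
  obtain ⟨p, hp, d, hd, hd0⟩ := exists_denom_eq_of_numUnstablePoles_eq_one hRL h1
  have hge : ∀ x : ℝ, 0 ≤ x → x < p → ‖freq g 0‖ ≤ ‖tf g x‖ := by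
    intro x hx hxp
    have := inv_enorm_tf_le_rir hRL hsp hd hd0 hx hxp
    rw [hr, hpk.1, ENNReal.inv_le_inv] at this
    exact enorm_le_iff_norm_le.1 this
  have h0 := hpk.freq_ne_zero
  have hder := deriv_tf_eq_deriv_phase_mul hRL hθ h0 hpk.norm_le
  have hd1 : HasDerivAt (fun x : ℝ => tf g x) (deriv θ 0 * freq g 0) 0 := by
    rw [← hder]
    have h2 := hasDerivAt_tf (hRL.1 0)
    have h3 : ((0 : ℝ) : ℂ) * Complex.I = ((0 : ℝ) : ℂ) := by simp
    rw [h3] at h2 ⊢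
    exact h2.comp_ofReal
  have hd2 := hd1.norm_sq
  have hin : inner ℝ (tf g (0 : ℝ)) (deriv θ 0 * freq g 0) = deriv θ 0 * ‖freq g 0‖ ^ 2 := by
    rw [← freq_zero, Complex.inner, mul_assoc, Complex.mul_conj', Complex.re_ofReal_mul]
    norm_cast
  rw [hin] at hd2
  have hslope := (hasDerivAt_iff_tendsto_slope.1 hd2).mono_left
    (nhdsWithin_mono (0 : ℝ) (s := Set.Ioi 0) (fun x (hx : 0 < x) => hx.ne'))
  have hnn : 0 ≤ 2 * (deriv θ 0 * ‖freq g 0‖ ^ 2) := by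
    refine ge_of_tendsto hslope ?_
    filter_upwards [self_mem_nhdsWithin, (gt_mem_nhds hp).filter_mono nhdsWithin_le_nhds]
      with x hx hxp
    have hx : 0 < x := hx
    rw [slope_def_field, sub_zero]
    refine div_nonneg (sub_nonneg.2 ?_) hx.le
    have := hge x hx.le hxp
    rw [← freq_zero]
    gcongr
  have : 0 < ‖freq g 0‖ ^ 2 := by positivity
  by_contra! hneg
  nlinarith [mul_neg_of_neg_of_pos hneg this]

/-! ### The Schwarz–Pick inequality for real functions on the right half plane -/

/-- The Schwarz–Pick inequality for the pair of points `s`, `conj s` and a function that is real on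
the real axis. -/
theorem norm_one_sub_sq_mul_re_le {f : ℂ → ℂ} (hf : ∀ s : ℂ, 0 < s.re → DifferentiableAt ℂ f s)
    (hlt : ∀ s : ℂ, 0 < s.re → ‖f s‖ < 1) (hconj : ∀ s, f (conj s) = conj (f s)) {s : ℂ}
    (hs : 0 < s.re) : ‖1 - f s ^ 2‖ * s.re ≤ (1 - ‖f s‖ ^ 2) * ‖s‖ := by
  have hs0 : s ≠ 0 := by rintro rfl; simp at hs
  have hns : 0 < ‖s‖ := norm_pos_iff.2 hs0
  set v := f s with hv
  have hv1 : ‖v‖ < 1 := hlt s hs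
  have hden : ∀ {w : ℂ}, ‖w‖ < 1 → 1 - v * w ≠ 0 := by
    intro w hw h
    have : ‖v * w‖ < 1 := by
      rw [norm_mul]
      exact mul_lt_one_of_nonneg_of_lt_one_left (norm_nonneg _) hv1 hw.le
    rw [← sub_eq_zero.1 h, norm_one] at this
    exact lt_irrefl _ this
  -- The conformal map of the unit disc onto the half plane that sends `0` to `conj s`.
  set c : ℂ → ℂ := fun w => (conj s + s * w) / (1 - w) with hc
  have hw1 : ∀ {w : ℂ}, ‖w‖ < 1 → 1 - w ≠ 0 := by
    intro w hw h
    rw [← sub_eq_zero.1 h, norm_one] at hw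
    exact lt_irrefl _ hw
  have hcre : ∀ w : ℂ, ‖w‖ < 1 → 0 < (c w).re := by
    intro w hw
    have h1 : 0 < Complex.normSq (1 - w) := Complex.normSq_pos.2 (hw1 hw)
    have h2 : Complex.normSq w < 1 := by
      rw [Complex.normSq_eq_norm_sq]
      exact pow_lt_one₀ (norm_nonneg _) hw two_ne_zero
    have h3 : (c w).re = s.re * (1 - Complex.normSq w) / Complex.normSq (1 - w) := by
      rw [hc, Complex.div_re]
      simp only [Complex.add_re, Complex.conj_re, Complex.mul_re, Complex.sub_re, Complex.one_re,
        Complex.add_im, Complex.conj_im, Complex.mul_im, Complex.sub_im, Complex.one_im,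
        Complex.normSq_apply]
      rw [← add_div]
      ring
    rw [h3]
    exact div_pos (mul_pos hs (sub_pos.2 h2)) h1
  -- The Schwarz lemma applies to `h`, a self-map of the disc that fixes `0`.
  set h : ℂ → ℂ := fun w => (f (c w) - conj v) / (1 - v * f (c w)) with hh
  have hmaps : Set.MapsTo h (Metric.ball 0 1) (Metric.closedBall 0 1) := by
    intro w hw
    rw [mem_ball_zero_iff] at hw
    rw [mem_closedBall_zero_iff]
    change ‖(f (c w) - conj v) / (1 - v * f (c w))‖ ≤ 1
    have hu := hlt _ (hcre w hw)
    generalize f (c w) = u at hu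
    have hd := norm_pos_iff.2 (hden hu)
    rw [norm_div, div_le_one hd]
    refine le_of_sq_le_sq ?_ hd.le
    have h1 : ‖u‖ ^ 2 < 1 := pow_lt_one₀ (norm_nonneg _) hu two_ne_zero
    have h2 : ‖v‖ ^ 2 < 1 := pow_lt_one₀ (norm_nonneg _) hv1 two_ne_zero
    rw [← Complex.normSq_eq_norm_sq, Complex.normSq_apply] at h1 h2 ⊢
    rw [← Complex.normSq_eq_norm_sq, Complex.normSq_apply]
    simp only [Complex.sub_re, Complex.sub_im, Complex.conj_re, Complex.conj_im, Complex.one_re,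
      Complex.one_im, Complex.mul_re, Complex.mul_im]
    nlinarith [mul_pos (sub_pos.2 h1) (sub_pos.2 h2)]
  have hc0 : c 0 = conj s := by simp [hc]
  have h0 : h 0 = 0 := by simp [hh, hc0, hconj, hv]
  have hdiff : DifferentiableOn ℂ h (Metric.ball 0 1) := by
    intro w hw
    rw [mem_ball_zero_iff] at hw
    have hcd : DifferentiableAt ℂ c w := by
      refine DifferentiableAt.div (by fun_prop) (by fun_prop) (hw1 hw)
    have hfc : DifferentiableAt ℂ (fun w => f (c w)) w := (hf _ (hcre w hw)).comp w hcd
    exact (DifferentiableAt.div (hfc.sub_const _) ((hfc.const_mul _).const_sub _)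
      (hden (hlt _ (hcre w hw)))).differentiableWithinAt
  -- This point of the disc is mapped to `s`.
  set w := (s - conj s) / (2 * s) with hw
  have hwn : ‖w‖ * ‖s‖ = |s.im| := by
    rw [hw, norm_div, Complex.sub_conj, norm_mul, norm_mul, Complex.norm_I, Complex.norm_real,
      Real.norm_eq_abs, abs_mul, RCLike.norm_two, abs_two]
    field_simp
  have hsq : ‖s‖ ^ 2 = s.re ^ 2 + s.im ^ 2 := by
    rw [← Complex.normSq_eq_norm_sq, Complex.normSq_apply]; ring
  have hwlt : ‖w‖ < 1 := by
    have : ‖w‖ * ‖s‖ < 1 * ‖s‖ := by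
      rw [hwn, one_mul]
      exact Complex.abs_im_lt_norm.2 hs.ne'
    exact lt_of_mul_lt_mul_right this hns.le
  have hcw : c w = s := by
    have h1 : 1 - w ≠ 0 := hw1 hwlt
    rw [hc]
    simp only
    rw [div_eq_iff h1, hw]
    field_simp
    ring
  have key := Complex.norm_le_norm_of_mapsTo_ball hdiff hmaps h0 hwlt
  have h1v : 1 - v * v ≠ 0 := hden hv1
  have hhw : ‖h w‖ * ‖1 - v ^ 2‖ = 2 * |v.im| := by
    rw [hh]
    simp only
    rw [hcw, ← hv, norm_div, pow_two, div_mul_cancel₀ _ (norm_ne_zero_iff.2 h1v),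
      Complex.sub_conj, norm_mul, Complex.norm_I, Complex.norm_real, Real.norm_eq_abs, abs_mul,
      abs_two, mul_one]
  have hab : 2 * |v.im| * ‖s‖ ≤ |s.im| * ‖1 - v ^ 2‖ := by
    rw [← hhw, ← hwn]
    calc ‖h w‖ * ‖1 - v ^ 2‖ * ‖s‖ ≤ ‖w‖ * ‖1 - v ^ 2‖ * ‖s‖ := by gcongr
      _ = _ := by ring
  have hab2 : 4 * v.im ^ 2 * ‖s‖ ^ 2 ≤ s.im ^ 2 * ‖1 - v ^ 2‖ ^ 2 := by
    have := pow_le_pow_left₀ (by positivity) hab 2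
    rw [mul_pow, mul_pow, mul_pow, sq_abs, sq_abs] at this
    linarith
  have hvsq : ‖1 - v ^ 2‖ ^ 2 = (1 - ‖v‖ ^ 2) ^ 2 + 4 * v.im ^ 2 := by
    rw [← Complex.normSq_eq_norm_sq, ← Complex.normSq_eq_norm_sq, Complex.normSq_apply,
      Complex.normSq_apply, pow_two v]
    simp only [Complex.sub_re, Complex.sub_im, Complex.one_re, Complex.one_im, Complex.mul_re,
      Complex.mul_im]
    ring
  have hv2 : 0 < 1 - ‖v‖ ^ 2 := sub_pos.2 (pow_lt_one₀ (norm_nonneg _) hv1 two_ne_zero)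
  refine le_of_sq_le_sq ?_ (by positivity)
  rw [mul_pow, mul_pow]
  have : (1 - ‖v‖ ^ 2) ^ 2 * ‖s‖ ^ 2 = ‖1 - v ^ 2‖ ^ 2 * ‖s‖ ^ 2 - 4 * v.im ^ 2 * ‖s‖ ^ 2 := by
    rw [hvsq]; ring
  rw [this, hsq]
  rw [hsq] at hab2
  linarith

/-! ### Necessity of the phase condition at a positive peak frequency -/

/-- The Schwarz–Pick defect of the interpolation condition `f s = μ / g s`: a function `f` of
modulus less than `1` on the right half plane and real on the real axis can only satisfy the
condition if the defect is nonnegative. -/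
noncomputable def pickDefect (g : RatFunc ℝ) (μ : ℝ) (s : ℂ) : ℝ :=
  (‖tf g s‖ ^ 2 - μ ^ 2) * ‖s‖ - s.re * ‖tf g s ^ 2 - (μ : ℂ) ^ 2‖

theorem pickDefect_conj (g : RatFunc ℝ) (μ : ℝ) (s : ℂ) :
    pickDefect g μ (conj s) = pickDefect g μ s := by
  have : conj (tf g s) ^ 2 - (μ : ℂ) ^ 2 = conj (tf g s ^ 2 - (μ : ℂ) ^ 2) := by simp
  rw [pickDefect, pickDefect, tf_conj, this, Complex.norm_conj, Complex.norm_conj,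
    Complex.norm_conj, Complex.conj_re]

theorem pickDefect_nonneg {g δ : RatFunc ℝ} (hδ : IsRHinf δ) {μ t : ℝ} (hμ : 0 < μ)
    (ht : t ∈ Set.Icc (0 : ℝ) 1) (hlt : ∀ s : ℂ, 0 ≤ s.re → ‖tf δ s‖ * μ < 1) {s : ℂ}
    (hs : 0 < s.re) (h1 : t * tf δ s * tf g s = 1) : 0 ≤ pickDefect g μ s := by
  set f : ℂ → ℂ := fun s => (t * μ : ℝ) * tf δ s with hf
  have hfn : ∀ s : ℂ, 0 < s.re → ‖f s‖ < 1 := by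
    intro s hs
    rw [hf]
    simp only
    rw [norm_mul, Complex.norm_real, Real.norm_of_nonneg (mul_nonneg ht.1 hμ.le)]
    calc t * μ * ‖tf δ s‖ ≤ 1 * μ * ‖tf δ s‖ := by
          gcongr
          exact ht.2
      _ = ‖tf δ s‖ * μ := by ring
      _ < 1 := hlt s hs.le
  have key := norm_one_sub_sq_mul_re_le (f := f)
    (fun s hs => (analyticAt_tf (hδ.not_isPole hs.le)).differentiableAt.const_mul _) hfn
    (fun s => by simp [hf, tf_conj]) hs
  have hg0 : tf g s ≠ 0 := by
    intro h; rw [h, mul_zero] at h1; exact zero_ne_one h1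
  have hfs : f s * tf g s = μ := by
    rw [hf]
    push_cast
    calc (t : ℂ) * μ * tf δ s * tf g s = μ * (t * tf δ s * tf g s) := by ring
      _ = μ := by rw [h1, mul_one]
  have hgn : 0 < ‖tf g s‖ ^ 2 := by positivity
  have h2 : ‖1 - f s ^ 2‖ * ‖tf g s‖ ^ 2 = ‖tf g s ^ 2 - (μ : ℂ) ^ 2‖ := by
    rw [← norm_pow, ← norm_mul, sub_mul, one_mul, ← mul_pow, hfs]
  have h3 : (1 - ‖f s‖ ^ 2) * ‖tf g s‖ ^ 2 = ‖tf g s‖ ^ 2 - μ ^ 2 := by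
    rw [sub_mul, one_mul, ← mul_pow, ← norm_mul, hfs, Complex.norm_real, Real.norm_eq_abs, sq_abs]
  rw [pickDefect, ← h2, ← h3]
  have := mul_le_mul_of_nonneg_right key hgn.le
  linarith

theorem norm_sq_sub_sq_eq {r θ : ℝ} (hr : 0 ≤ r) :
    ‖((r : ℂ) * Complex.exp (θ * Complex.I)) ^ 2 - (r : ℂ) ^ 2‖ = 2 * r ^ 2 * |Real.sin θ| := by
  have h : ((r : ℂ) * Complex.exp (θ * Complex.I)) ^ 2 - (r : ℂ) ^ 2 =
      (r : ℂ) ^ 2 * Complex.exp (θ * Complex.I) * (2 * Complex.I * (Real.sin θ : ℂ)) := by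
    have h1 : (Complex.cos θ) ^ 2 = 1 - (Complex.sin θ) ^ 2 := by
      rw [← Complex.sin_sq_add_cos_sq (θ : ℂ)]; ring
    rw [Complex.exp_mul_I, Complex.ofReal_sin]
    linear_combination (r : ℂ) ^ 2 * h1 - (r : ℂ) ^ 2 * (Complex.sin θ) ^ 2 * Complex.I_sq
  rw [h, norm_mul, norm_mul, Complex.norm_exp_ofReal_mul_I, norm_mul, norm_mul, Complex.norm_I,
    Complex.norm_real, norm_pow, Complex.norm_real, Real.norm_of_nonneg hr, RCLike.norm_two,
    Real.norm_eq_abs]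
  ring

/-- If the phase condition fails strictly, the Schwarz–Pick defect is negative on the part of the
closed right half plane near the peak `jωp`. -/
theorem exists_ball_pickDefect_neg {g : RatFunc ℝ} (hg : IsRLinf g) {ωp : ℝ} (hωp : 0 < ωp)
    (hpk : IsUniquePeak g ωp) {θ : ℝ → ℝ} (hθ : IsPhase g θ)
    (hlt : deriv θ ωp < |Real.sin (θ ωp) / ωp|) :
    ∃ r > 0, ∀ s ∈ Metric.ball (ωp * Complex.I) r, ¬ IsPole g s ∧
      (0 ≤ s.re → s ≠ ωp * Complex.I → pickDefect g ‖freq g ωp‖ s < 0) := by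
  set z₀ : ℂ := ωp * Complex.I with hz₀
  set γ := ‖freq g ωp‖ with hγ
  have h0 := hpk.freq_ne_zero
  have hγ0 : 0 < γ := norm_pos_iff.2 h0
  have han : AnalyticAt ℂ (tf g) z₀ := analyticAt_tf (hg.1 ωp)
  have hz₀n : ‖z₀‖ = ωp := by simp [hz₀, abs_of_pos hωp]
  have hz₀0 : ‖z₀‖ ≠ 0 := hz₀n ▸ hωp.ne'
  -- The derivative of `|g|²` in the direction of the real axis.
  set P' : ℂ → ℝ := fun s => 2 * inner ℝ (tf g s) (deriv (tf g) s) with hP'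
  set q : ℂ → ℝ := fun s => ‖tf g s ^ 2 - (γ : ℂ) ^ 2‖ / ‖s‖ with hq
  have hP'z : P' z₀ = 2 * γ ^ 2 * deriv θ ωp := by
    rw [hP']
    simp only
    rw [hz₀, deriv_tf_eq_deriv_phase_mul hg hθ h0 hpk.norm_le]
    change 2 * inner ℝ (freq g ωp) _ = _
    rw [Complex.inner, mul_assoc, Complex.mul_conj', Complex.re_ofReal_mul]
    norm_cast
    rw [← hγ]
    ring
  have hqz : q z₀ = 2 * γ ^ 2 * |Real.sin (θ ωp) / ωp| := by
    rw [hq]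
    simp only
    rw [hz₀n]
    change ‖freq g ωp ^ 2 - (γ : ℂ) ^ 2‖ / ωp = _
    rw [hθ.2 ωp, ← hγ, norm_sq_sub_sq_eq hγ0.le, abs_div, abs_of_pos hωp]
    ring
  have hPq : P' z₀ < q z₀ := by
    rw [hP'z, hqz]
    gcongr
  obtain ⟨K, hK1, hK2⟩ := exists_between hPq
  have hcP : ContinuousAt P' z₀ :=
    (han.continuousAt.inner han.deriv.continuousAt).const_mul 2
  have hcq : ContinuousAt q z₀ :=
    ((han.continuousAt.pow 2).sub continuousAt_const).norm.div continuousAt_id.norm hz₀0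
  have hpole : ∀ᶠ s in 𝓝 z₀, ¬ IsPole g s :=
    (Polynomial.continuous_aeval g.denom).continuousAt.eventually_ne (hg.1 ωp)
  have him : ∀ᶠ s : ℂ in 𝓝 z₀, 0 < s.im :=
    Complex.continuous_im.continuousAt.eventually (lt_mem_nhds (by simpa [hz₀] using hωp))
  obtain ⟨r, hr, hball⟩ := Metric.eventually_nhds_iff_ball.1
    ((hcP.eventually (gt_mem_nhds hK1)).and ((hcq.eventually (lt_mem_nhds hK2)).and
      (hpole.and him)))
  refine ⟨r, hr, fun s hs => ⟨(hball s hs).2.2.1, fun hre hne => ?_⟩⟩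
  have hs_im : 0 < s.im := (hball s hs).2.2.2
  have hsn : 0 < ‖s‖ := norm_pos_iff.2 fun h => by simp [h] at hs_im
  have hseq : s = (s.re : ℂ) + s.im * Complex.I := (Complex.re_add_im s).symm
  rcases hre.eq_or_lt with hre0 | hre0
  · have h1 : ‖tf g s‖ < γ := by
      rw [tf_eq_freq g hre0.symm]
      refine hpk.2 _ (fun h => hne ?_) (fun h => by linarith)
      rw [hseq, ← hre0, h, Complex.ofReal_zero, zero_add]
    rw [pickDefect, ← hre0, zero_mul, sub_zero]
    refine mul_neg_of_neg_of_pos (sub_neg.2 ?_) hsn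
    gcongr
  · have hline : ∀ u ∈ Set.Icc 0 s.re, (u : ℂ) + s.im * Complex.I ∈ Metric.ball z₀ r := by
      intro u hu
      rw [mem_ball_iff_norm] at hs ⊢
      refine lt_of_le_of_lt ?_ hs
      refine le_of_sq_le_sq ?_ (norm_nonneg _)
      rw [← Complex.normSq_eq_norm_sq, ← Complex.normSq_eq_norm_sq, Complex.normSq_apply,
        Complex.normSq_apply]
      simp [hz₀]
      nlinarith [hu.1, hu.2]
    have hd : ∀ u ∈ Set.Icc 0 s.re, HasDerivAt
        (fun u : ℝ => ‖tf g ((u : ℂ) + s.im * Complex.I)‖ ^ 2)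
        (P' ((u : ℂ) + s.im * Complex.I)) u := by
      intro u hu
      have h1 := hasDerivAt_tf (hball _ (hline u hu)).2.2.1
      have h2 : HasDerivAt (fun u : ℝ => (u : ℂ) + s.im * Complex.I) 1 u := by
        simpa using (Complex.ofRealCLM.hasDerivAt (x := u)).add_const (s.im * Complex.I)
      have h3 := HasDerivAt.comp (h₂ := tf g) (h := fun u : ℝ => (u : ℂ) + s.im * Complex.I) u h1 h2
      rw [mul_one] at h3
      exact h3.norm_sq
    -- Compare `s` with the point `j Im s` of the axis, where the gain is at most `γ`.
    have hmvt := (convex_Icc 0 s.re).image_sub_le_mul_sub_of_deriv_le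
      (f := fun u : ℝ => ‖tf g ((u : ℂ) + s.im * Complex.I)‖ ^ 2) (C := K)
      (fun u hu => (hd u hu).continuousAt.continuousWithinAt)
      (fun u hu => (hd u (interior_subset hu)).differentiableAt.differentiableWithinAt)
      (fun u hu => by
        rw [(hd u (interior_subset hu)).deriv]
        exact (hball _ (hline u (interior_subset hu))).1.le)
      0 ⟨le_rfl, hre⟩ s.re ⟨hre, le_rfl⟩ hre
    rw [← hseq, sub_zero] at hmvt
    have h1 : ‖tf g (((0 : ℝ) : ℂ) + s.im * Complex.I)‖ ≤ γ := by
      rw [Complex.ofReal_zero, zero_add]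
      exact hpk.norm_le s.im
    have h2 : ‖tf g (((0 : ℝ) : ℂ) + s.im * Complex.I)‖ ^ 2 ≤ γ ^ 2 := by gcongr
    have h3 : K < q s := (hball s hs).2.1
    have h4 : q s * ‖s‖ = ‖tf g s ^ 2 - (γ : ℂ) ^ 2‖ := div_mul_cancel₀ _ hsn.ne'
    have h5 : ‖tf g s‖ ^ 2 - γ ^ 2 < s.re * q s := by nlinarith
    rw [pickDefect, ← h4]
    have := mul_lt_mul_of_pos_right h5 hsn
    linarith

/-- If the small gain bound is attained at a positive peak frequency, the phase derivative there is
at least `|sin θ| / ωp`. -/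
theorem abs_sin_div_le_deriv_phase_of_rir_eq {g : RatFunc ℝ} (hg : g ∈ classG) {ωp : ℝ}
    (hωp : 0 < ωp) (hpk : IsUniquePeak g ωp) {θ : ℝ → ℝ} (hθ : IsPhase g θ)
    (hr : rir g = (linfNorm g)⁻¹) : |Real.sin (θ ωp) / ωp| ≤ deriv θ ωp := by
  by_contra! hcon
  obtain ⟨hRL, hsp, hun⟩ := id hg
  obtain ⟨p, hp, hpre⟩ := exists_isPole_re_pos hg
  obtain ⟨r₀, hr₀, hball⟩ := exists_ball_pickDefect_neg hRL hωp hpk hθ hcon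
  set z₀ : ℂ := ωp * Complex.I with hz₀
  set γ := ‖freq g ωp‖ with hγ
  have hγ0 : 0 < γ := norm_pos_iff.2 hpk.freq_ne_zero
  set r := r₀ / 2 with hrdef
  have hr0 : 0 < r := half_pos hr₀
  have hrr : r < r₀ := half_lt_self hr₀
  -- The right half plane with the half discs around `± jωp` removed.
  set Ω : Set ℂ := {s | 0 < s.re} ∩ ({s | r < dist s z₀} ∩ {s | r < dist (conj s) z₀}) with hΩ
  have hc1 : Continuous fun s : ℂ => dist s z₀ := by fun_prop
  have hc2 : Continuous fun s : ℂ => dist (conj s) z₀ :=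
    hc1.comp Complex.continuous_conj
  have hΩo : IsOpen Ω := isOpen_re_pos.inter
    ((isOpen_lt continuous_const hc1).inter (isOpen_lt continuous_const hc2))
  have hfr : ∀ s ∈ frontier Ω, 0 ≤ s.re ∧ r ≤ dist s z₀ ∧ r ≤ dist (conj s) z₀ ∧
      (s.re = 0 ∨ dist s z₀ = r ∨ dist (conj s) z₀ = r) := by
    intro s hs
    rw [hΩo.frontier_eq] at hs
    have hcl : closure Ω ⊆ {s | 0 ≤ s.re} ∩ ({s | r ≤ dist s z₀} ∩ {s | r ≤ dist (conj s) z₀}) :=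
      closure_minimal (fun s ⟨h1, h2, h3⟩ => ⟨Set.mem_ofPred.2 (Set.mem_ofPred.1 h1).le,
        Set.mem_ofPred.2 (Set.mem_ofPred.1 h2).le, Set.mem_ofPred.2 (Set.mem_ofPred.1 h3).le⟩)
        ((isClosed_le continuous_const Complex.continuous_re).inter
          ((isClosed_le continuous_const hc1).inter (isClosed_le continuous_const hc2)))
    obtain ⟨h1, h2, h3⟩ := hcl hs.1
    refine ⟨h1, h2, h3, ?_⟩
    by_contra! hne
    exact hs.2 ⟨lt_of_le_of_ne h1 hne.1.symm, lt_of_le_of_ne h2 hne.2.1.symm,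
      lt_of_le_of_ne h3 hne.2.2.symm⟩
  have hin : ∀ s, dist s z₀ = r → s ∈ Metric.ball z₀ r₀ := fun s hs =>
    Metric.mem_ball.2 (hs ▸ hrr)
  have hpole : ∀ s ∈ frontier Ω, ¬ IsPole g s := by
    intro s hs
    obtain ⟨-, -, -, h | h | h⟩ := hfr s hs
    · exact hRL.not_isPole h
    · exact (hball s (hin s h)).1
    · rw [← isPole_conj]
      exact (hball _ (hin _ h)).1
  have hpΩ : p ∈ Ω := by
    refine ⟨hpre, ?_, ?_⟩
    · by_contra hle
      exact (hball p (Metric.mem_ball.2 ((not_lt.1 hle).trans_lt hrr))).1 hp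
    · by_contra hle
      exact (hball _ (Metric.mem_ball.2 ((not_lt.1 hle).trans_lt hrr))).1 (isPole_conj.2 hp)
  -- At each boundary point one of the two conditions for `t δ g = 1` with `‖δ‖ ≤ 1 / γ` fails; by
  -- compactness this persists when `γ` is replaced by a slightly smaller `μ`.
  have hnear : ∀ s ∈ frontier Ω, ‖tf g s‖ < γ ∨ pickDefect g γ s < 0 := by
    intro s hs
    obtain ⟨h1, h2, h3, h | h | h⟩ := hfr s hs
    · left
      have hseq : s = s.im * Complex.I := by apply Complex.ext <;> simp [h]
      rw [tf_eq_freq g h]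
      refine hpk.2 _ (fun h' => ?_) (fun h' => ?_)
      · rw [hseq, h', hz₀, dist_self] at h2
        exact absurd h2 (not_le.2 hr0)
      · rw [hseq, h'] at h3
        simp [hz₀] at h3
        exact absurd h3 (not_le.2 hr0)
    · right
      refine (hball s (hin s h)).2 h1 fun h' => ?_
      rw [h', dist_self] at h
      exact hr0.ne h
    · right
      rw [← pickDefect_conj]
      refine (hball _ (hin _ h)).2 (by simpa using h1) fun h' => ?_
      rw [h', dist_self] at h
      exact hr0.ne h
  obtain ⟨R, hR⟩ : ∃ R, ∀ s, ¬ ‖tf g s‖ < γ / 2 → ‖s‖ ≤ R := by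
    have h1 : ∀ᶠ s in cobounded ℂ, ‖tf g s‖ < γ / 2 := by
      have := (tendsto_tf_cobounded hsp).norm
      rw [norm_zero] at this
      exact this.eventually (gt_mem_nhds (half_pos hγ0))
    have h2 : IsBounded {s : ℂ | ¬ ‖tf g s‖ < γ / 2} := by
      rw [isBounded_def]
      filter_upwards [h1] with s hs using by simpa using hs
    exact h2.exists_norm_le
  have hcomp : IsCompact (Metric.closedBall (0 : ℂ) R ∩ frontier Ω) :=
    (isCompact_closedBall _ _).inter_right isClosed_frontier
  have hloc : ∀ s ∈ Metric.closedBall (0 : ℂ) R ∩ frontier Ω, ∀ᶠ x : ℝ × ℂ in 𝓝 (γ, s),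
      ‖tf g x.2‖ < x.1 ∨ pickDefect g x.1 x.2 < 0 := by
    intro s hs
    have hct : ContinuousAt (tf g) s := (analyticAt_tf (hpole s hs.2)).continuousAt
    have hct' : ContinuousAt (fun x : ℝ × ℂ => tf g x.2) (γ, s) :=
      ContinuousAt.comp (g := tf g) (f := fun x : ℝ × ℂ => x.2) hct continuousAt_snd
    rcases hnear s hs.2 with h | h
    · filter_upwards [hct'.norm.eventually_lt continuousAt_fst h] with x hx using Or.inl hx
    · have : ContinuousAt (fun x : ℝ × ℂ => pickDefect g x.1 x.2) (γ, s) := by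
        unfold pickDefect
        fun_prop
      filter_upwards [this.eventually (gt_mem_nhds h)] with x hx using Or.inr hx
  have hall := hcomp.eventually_forall_of_forall_eventually
    (x₀ := γ) (P := fun μ s => ‖tf g s‖ < μ ∨ pickDefect g μ s < 0) hloc
  have hbelow : ∀ᶠ μ in 𝓝[<] γ, μ < γ := self_mem_nhdsWithin
  obtain ⟨μ, hμ, hμγ, hμ2⟩ := ((hall.filter_mono nhdsWithin_le_nhds).and (hbelow.and
    ((lt_mem_nhds (half_lt_self hγ0)).filter_mono nhdsWithin_le_nhds))).exists
  have hμ0 : 0 < μ := (half_pos hγ0).trans hμ2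
  -- No stabilising perturbation has norm below `1 / μ`, although `μ < ‖g‖`.
  have hrir : (ENNReal.ofReal μ)⁻¹ ≤ rir g := by
    refine le_iInf₂ fun δ hδ => ?_
    by_contra! hlt
    have hfin : hinfNorm δ ≠ ⊤ := hlt.ne_top
    have hsmall : ∀ s : ℂ, 0 ≤ s.re → ‖tf δ s‖ * μ < 1 := by
      intro s hs
      have h1 := norm_tf_le_of_hinfNorm_le hδ.1 ENNReal.toReal_nonneg
        (ENNReal.ofReal_toReal hfin).ge hs
      have h2 : (hinfNorm δ).toReal < μ⁻¹ := by
        rw [← ENNReal.ofReal_inv_of_pos hμ0] at hlt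
        exact (ENNReal.lt_ofReal_iff_toReal_lt hfin).1 hlt
      calc ‖tf δ s‖ * μ < μ⁻¹ * μ := by
            gcongr
            exact h1.trans_lt h2
        _ = 1 := inv_mul_cancel₀ hμ0.ne'
    obtain ⟨t, ht, s, hs, hre, h1⟩ := exists_frontier_mul_eq_one hRL hsp hδ hfin hΩo
      (fun s hs => hs.1) hpΩ hp hpole
    have hgs : μ < ‖tf g s‖ := by
      have h2 : t * ‖tf δ s‖ * ‖tf g s‖ = 1 := by
        have := congrArg norm h1
        rwa [norm_mul, norm_mul, Complex.norm_real, Real.norm_of_nonneg ht.1, norm_one] at this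
      by_contra! hle
      have h3 : t * ‖tf δ s‖ * ‖tf g s‖ ≤ 1 * ‖tf δ s‖ * μ := by
        gcongr
        exact ht.2
      linarith [hsmall s hre]
    have hsR : s ∈ Metric.closedBall (0 : ℂ) R :=
      mem_closedBall_zero_iff.2 (hR s (not_lt.2 (hμ2.trans hgs).le))
    rcases hμ s ⟨hsR, hs⟩ with h | h
    · exact absurd h (not_lt.2 hgs.le)
    · rcases hre.eq_or_lt with h0 | h0
      · rw [pickDefect, ← h0, zero_mul, sub_zero] at h
        refine absurd h (not_lt.2 (mul_nonneg (sub_nonneg.2 ?_) (norm_nonneg _)))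
        gcongr
      · exact absurd h (not_lt.2 (pickDefect_nonneg hδ.1 hμ0 ht hsmall h0 h1))
  rw [hr, hpk.1, ENNReal.inv_le_inv, ← ofReal_norm, ENNReal.ofReal_le_ofReal_iff hμ0.le] at hrir
  exact absurd hrir (not_le.2 hμγ)

/-! ### Perturbations given as quotients of polynomials -/

theorem not_isPole_div {a b : ℝ[X]} {s : ℂ} (hb : aeval s b ≠ 0) :
    ¬ IsPole (algebraMap ℝ[X] (RatFunc ℝ) a / algebraMap ℝ[X] (RatFunc ℝ) b) s := by
  intro h
  obtain ⟨e, he⟩ := RatFunc.denom_div_dvd a b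
  refine hb ?_
  have h : aeval s _ = 0 := h
  rw [he, map_mul, h, zero_mul]

theorem tf_div {a b : ℝ[X]} {s : ℂ} (hb : aeval s b ≠ 0) :
    tf (algebraMap ℝ[X] (RatFunc ℝ) a / algebraMap ℝ[X] (RatFunc ℝ) b) s =
      aeval s a / aeval s b := by
  have hb0 : b ≠ 0 := by rintro rfl; simp at hb
  have h := congrArg (aeval s) ((RatFunc.num_mul_eq_mul_denom_iff
    (x := algebraMap ℝ[X] (RatFunc ℝ) a / algebraMap ℝ[X] (RatFunc ℝ) b) (p := a) hb0).2 rfl)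
  have hd : aeval s (algebraMap ℝ[X] (RatFunc ℝ) a / algebraMap ℝ[X] (RatFunc ℝ) b).denom ≠ 0 :=
    not_isPole_div hb
  rw [map_mul, map_mul] at h
  rw [tf_eq, div_eq_div_iff hd hb, h]

theorem div_mem_stabilizing {g : RatFunc ℝ} {a b : ℝ[X]} {M : ℝ}
    (hb : ∀ s : ℂ, 0 ≤ s.re → aeval s b ≠ 0)
    (hM : ∀ s : ℂ, 0 ≤ s.re → ‖aeval s a‖ ≤ M * ‖aeval s b‖)
    (hroot : ∀ s : ℂ, 0 ≤ s.re → aeval s (b * g.denom - a * g.num) ≠ 0) :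
    algebraMap ℝ[X] (RatFunc ℝ) a / algebraMap ℝ[X] (RatFunc ℝ) b ∈ stabilizing g ∧
      hinfNorm (algebraMap ℝ[X] (RatFunc ℝ) a / algebraMap ℝ[X] (RatFunc ℝ) b) ≤
        ENNReal.ofReal M := by
  have hbd : ∀ s : ℂ, 0 ≤ s.re →
      ‖tf (algebraMap ℝ[X] (RatFunc ℝ) a / algebraMap ℝ[X] (RatFunc ℝ) b) s‖ ≤ M := by
    intro s hs
    rw [tf_div (hb s hs), norm_div, div_le_iff₀ (norm_pos_iff.2 (hb s hs))]
    exact hM s hs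
  refine ⟨⟨⟨⟨fun ω => not_isPole_div (hb _ (by simp)), M, fun ω => hbd _ (by simp)⟩,
    fun s hs => ?_⟩, fun s hs => ?_, fun s hs hre hp => ?_⟩, ?_⟩
  · by_contra hre
    exact not_isPole_div (hb s (not_lt.1 hre)) hs
  · by_contra! hre
    have hd : aeval s g.denom ≠ 0 := by
      intro hd
      rw [tf_eq g, hd, div_zero, mul_zero] at hs
      exact zero_ne_one hs
    rw [tf_div (hb s hre), tf_eq, div_mul_div_comm, div_eq_one_iff_eq (mul_ne_zero (hb s hre) hd)]
      at hs
    refine hroot s hre ?_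
    rw [map_sub, map_mul, map_mul, hs, sub_self]
  · rw [tf_div (hb s hre.le), div_eq_zero_iff, or_iff_left (hb s hre.le)] at hs
    have hp : aeval s g.denom = 0 := hp
    refine hroot s hre.le ?_
    rw [map_sub, map_mul, map_mul, hs, hp, mul_zero, zero_mul, sub_self]
  · refine iSup₂_le fun s hs => ?_
    rw [← ofReal_norm]
    exact ENNReal.ofReal_le_ofReal (hbd s hs.le)

/-! ### Sufficiency of the phase condition -/

/-- For every angle there is a real all-pass function `a / b` of order at most one with value
`exp (-jθ)` at `jω`; its phase derivative there is `-|sin θ| / ω`, the largest possible. For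
`sin θ = 0` the function is the constant `±1` and `ω = 0` is allowed. -/
theorem exists_allpass (θ : ℝ) {ω : ℝ} (hω : 0 < ω ∨ Real.sin θ = 0) :
    ∃ a b : ℝ[X], a.degree ≤ b.degree ∧ (∀ s : ℂ, 0 ≤ s.re → aeval s b ≠ 0) ∧
      (∀ s : ℂ, 0 ≤ s.re → ‖aeval s a‖ ≤ ‖aeval s b‖) ∧
      aeval (ω * Complex.I) a / aeval (ω * Complex.I) b = Complex.exp (-(θ * Complex.I)) ∧
      HasDerivAt (fun s : ℂ => aeval s a / aeval s b)
        (-(|Real.sin θ / ω| : ℝ) * Complex.exp (-(θ * Complex.I))) (ω * Complex.I) := by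
  have hexp : Complex.exp (-(θ * Complex.I)) = (Real.cos θ : ℂ) - Real.sin θ * Complex.I := by
    rw [← neg_mul, Complex.exp_mul_I, Complex.cos_neg, Complex.sin_neg, Complex.ofReal_cos,
      Complex.ofReal_sin]
    ring
  rcases eq_or_ne (Real.sin θ) 0 with h0 | h0
  · refine ⟨C (Real.cos θ), 1, ?_, ?_, ?_, ?_, ?_⟩
    · rw [degree_one]; exact degree_C_le
    · intro s _; simp
    · intro s _
      rw [aeval_C, map_one, norm_one, Complex.coe_algebraMap, Complex.norm_real]
      exact Real.abs_cos_le_one θ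
    · rw [hexp, h0]; simp
    · rw [h0]
      simpa using hasDerivAt_const (ω * Complex.I) (Real.cos θ : ℂ)
  · have hω : 0 < ω := hω.resolve_right h0
    obtain ⟨σ, S, hσ, hS, hσS⟩ : ∃ σ S : ℝ, σ * σ = 1 ∧ 0 < S ∧ Real.sin θ = -(σ * S) := by
      rcases h0.lt_or_gt with h | h
      · exact ⟨1, -Real.sin θ, by norm_num, by linarith, by ring⟩
      · exact ⟨-1, Real.sin θ, by norm_num, h, by ring⟩
    have hσabs : |σ| = 1 := by
      have : |σ| * |σ| = 1 := by rw [← abs_mul, hσ, abs_one]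
      nlinarith [abs_nonneg σ]
    have habs : |Real.sin θ / ω| = S / ω := by
      rw [hσS, abs_div, abs_neg, abs_mul, hσabs, one_mul, abs_of_pos hS, abs_of_pos hω]
    set c := σ * Real.cos θ with hc
    have hcos : Real.cos θ = σ * c := by rw [hc, ← mul_assoc, hσ, one_mul]
    have hcS : c * c + S * S = 1 := by
      have := Real.cos_sq_add_sin_sq θ
      rw [hσS, hcos] at this
      linear_combination this - (c * c + S * S) * hσ
    have hc1 : 0 < 1 + c := by nlinarith [mul_pos hS hS]
    -- The zero `α` of the all-pass function is determined by the required value at `jω`.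
    set α := ω * S / (1 + c) with hα
    have hα0 : 0 < α := by positivity
    have e1 : α * (1 + c) = S * ω := by rw [hα]; field_simp
    have e2 : ω * (1 - c) = S * α := by
      have : (1 + c) * (ω * (1 - c)) = (1 + c) * (S * α) := by
        linear_combination -S * e1 - ω * hcS
      exact mul_left_cancel₀ hc1.ne' this
    have haev : ∀ s : ℂ, aeval s (C σ * (X - C α)) = σ * (s - α) := fun s => by simp
    have hbev : ∀ s : ℂ, aeval s (X + C α) = s + α := fun s => by simp
    have hb : ∀ s : ℂ, 0 ≤ s.re → s + α ≠ 0 := by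
      intro s hs h
      have := congrArg Complex.re h
      simp at this
      linarith
    have hz : (ω * Complex.I + α : ℂ) ≠ 0 := hb _ (by simp)
    have e1' : (α : ℂ) * (1 + c) = S * ω := by exact_mod_cast e1
    have e2' : (ω : ℂ) * (1 - c) = S * α := by exact_mod_cast e2
    have hval : (σ * (ω * Complex.I - α) : ℂ) =
        Complex.exp (-(θ * Complex.I)) * (ω * Complex.I + α) := by
      rw [hexp, hcos, hσS]
      push_cast
      linear_combination (-σ : ℂ) * e1' + (σ : ℂ) * Complex.I * e2' - (σ * S * ω : ℂ) * Complex.I_sq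
    refine ⟨C σ * (X - C α), X + C α, ?_, ?_, ?_, ?_, ?_⟩
    · rw [degree_X_add_C, ← smul_eq_C_mul]
      exact (degree_smul_le _ _).trans (degree_X_sub_C_le α)
    · intro s hs
      rw [hbev]
      exact hb s hs
    · intro s hs
      rw [haev, hbev, norm_mul, Complex.norm_real, Real.norm_eq_abs, hσabs, one_mul]
      refine le_of_sq_le_sq ?_ (norm_nonneg _)
      rw [← Complex.normSq_eq_norm_sq, ← Complex.normSq_eq_norm_sq, Complex.normSq_apply,
        Complex.normSq_apply]
      simp only [Complex.sub_re, Complex.add_re, Complex.sub_im, Complex.add_im,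
        Complex.ofReal_re, Complex.ofReal_im]
      nlinarith [mul_nonneg hs hα0.le]
    · rw [haev, hbev, div_eq_iff hz, hval]
    · simp only [haev, hbev]
      have hd := (((hasDerivAt_id (ω * Complex.I : ℂ)).sub_const (α : ℂ)).const_mul (σ : ℂ)).div
        ((hasDerivAt_id (ω * Complex.I : ℂ)).add_const (α : ℂ)) hz
      refine hd.congr_deriv ?_
      have hω' : (ω : ℂ) ≠ 0 := by exact_mod_cast hω.ne'
      have hexp' : Complex.exp (-(θ * Complex.I)) =
          σ * (ω * Complex.I - α) / (ω * Complex.I + α) := by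
        rw [hval, mul_div_cancel_right₀ _ hz]
      rw [habs, hexp']
      simp only [id]
      push_cast
      field_simp
      linear_combination (σ * S * ω ^ 2 : ℂ) * Complex.I_sq + (σ * α : ℂ) * e2' + (σ * ω : ℂ) * e1'

open Classical in
/-- If the phase condition holds strictly at the peak and the unstable poles are as many as the
peak points `± jωp`, then all-pass perturbations of norm just above `1 / ‖g‖` stabilise `g`. -/
theorem rir_le_of_abs_sin_div_lt_deriv_phase {g : RatFunc ℝ} (hg : g ∈ classG) {ωp : ℝ}
    (hpk : IsUniquePeak g ωp) {θ : ℝ → ℝ} (hθ : IsPhase g θ)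
    (hω : 0 < ωp ∨ Real.sin (θ ωp) = 0)
    (hcard : numUnstablePoles g =
      ({(ωp : ℂ) * Complex.I, conj ((ωp : ℂ) * Complex.I)} : Finset ℂ).card)
    (hlt : |Real.sin (θ ωp) / ωp| < deriv θ ωp) : rir g ≤ (linfNorm g)⁻¹ := by
  obtain ⟨hRL, hsp, -⟩ := hg
  obtain ⟨a, b, hdeg, hb, hab, hval, hder⟩ := exists_allpass (θ ωp) hω
  set z₀ : ℂ := ωp * Complex.I with hz₀
  set γ := ‖freq g ωp‖ with hγ
  have hγ0 : 0 < γ := norm_pos_iff.2 hpk.freq_ne_zero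
  have hγ0' : (γ : ℂ) ≠ 0 := by exact_mod_cast hγ0.ne'
  set ψ := deriv θ ωp - |Real.sin (θ ωp) / ωp| with hψ
  have hψ0 : 0 < ψ := sub_pos.2 hlt
  set n : ℝ[X] := C γ⁻¹ * a with hn
  set E : ℂ[X] := (b * g.denom).map (algebraMap ℝ ℂ) with hE
  set N : ℂ[X] := (n * g.num).map (algebraMap ℝ ℂ) with hN
  have hb0 : b ≠ 0 := by
    rintro rfl
    simpa using hb 0 le_rfl
  have hz₀re : z₀.re = 0 := by simp [hz₀]
  have hEv : ∀ s : ℂ, E.eval s = aeval s b * aeval s g.denom := fun s => by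
    rw [hE, eval_map_algebraMap, map_mul]
  have hNv : ∀ s : ℂ, N.eval s = (γ : ℂ)⁻¹ * aeval s a * aeval s g.num := fun s => by
    rw [hN, eval_map_algebraMap, map_mul, hn, map_mul, aeval_C]
    simp
  have hE0 : ∀ s : ℂ, s.re = 0 → E.eval s ≠ 0 := fun s hs => by
    rw [hEv]
    exact mul_ne_zero (hb s hs.ge) (hRL.not_isPole hs)
  set L : ℂ → ℂ := fun s => N.eval s / E.eval s with hL
  have hLeq : ∀ s : ℂ, L s = (γ : ℂ)⁻¹ * (aeval s a / aeval s b * tf g s) := fun s => by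
    rw [hL]
    simp only [hEv, hNv, tf_eq]
    rw [mul_assoc, mul_div_assoc, div_mul_div_comm]
  have hLconj : ∀ s, L (conj s) = conj (L s) := fun s => by
    simp only [hLeq, aeval_conj, tf_conj, map_mul, map_div₀, map_inv₀, Complex.conj_ofReal]
  have hgz : tf g z₀ = γ * Complex.exp (θ ωp * Complex.I) := hθ.2 ωp
  have hexp : Complex.exp (-(θ ωp * Complex.I)) * Complex.exp (θ ωp * Complex.I) = 1 := by
    rw [← Complex.exp_add, neg_add_cancel, Complex.exp_zero]
  have hL1 : L z₀ = 1 := by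
    rw [hLeq, hval, hgz]
    field_simp
    exact hexp
  have hLd : HasDerivAt L ψ z₀ := by
    have h1 := (hder.mul (hasDerivAt_tf (hRL.1 ωp))).const_mul (γ : ℂ)⁻¹
    rw [deriv_tf_eq_deriv_phase_mul hRL hθ hpk.freq_ne_zero hpk.norm_le, hval] at h1
    have h2 : freq g ωp = γ * Complex.exp (θ ωp * Complex.I) := hgz
    rw [hgz, h2] at h1
    refine (h1.congr_of_eventuallyEq (Eventually.of_forall fun s => hLeq s)).congr_deriv ?_
    rw [hψ]
    push_cast
    field_simp
    linear_combination (((deriv θ ωp : ℝ) : ℂ) - (|Real.sin (θ ωp) / ωp| : ℝ)) * hexp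
  have hLd' : HasDerivAt L ψ (conj z₀) := by
    have h1 := hLd.conj_conj
    rw [Complex.conj_ofReal] at h1
    refine h1.congr_of_eventuallyEq (Eventually.of_forall fun s => ?_)
    simp [hLconj]
  have hdegEN : N.degree < E.degree := by
    rw [hE, hN, degree_map, degree_map]
    refine degree_mul_lt_degree_mul hb0 ?_ hsp
    rw [hn, ← smul_eq_C_mul]
    exact (degree_smul_le _ _).trans hdeg
  have hcount : E.roots.countP (fun s => 0 < s.re) = ({z₀, conj z₀} : Finset ℂ).card := by
    have hne : b * g.denom ≠ 0 := mul_ne_zero hb0 g.denom_ne_zero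
    have h1 : E.roots = b.aroots ℂ + g.denom.aroots ℂ := aroots_mul hne
    have h2 : Multiset.countP (fun s : ℂ => 0 < s.re) (b.aroots ℂ) = 0 := by
      rw [Multiset.countP_eq_zero]
      intro s hs hre
      exact hb s hre.le ((mem_aroots.1 hs).2)
    rw [h1, Multiset.countP_add, h2, zero_add, ← hcard, numUnstablePoles]
  have hmem : ∀ z ∈ ({z₀, conj z₀} : Finset ℂ), z = z₀ ∨ z = conj z₀ := by
    intro z hz
    simpa using hz
  have hre : ∀ z ∈ ({z₀, conj z₀} : Finset ℂ), z.re = 0 := by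
    intro z hz
    rcases hmem z hz with rfl | rfl
    · exact hz₀re
    · rw [Complex.conj_re, hz₀re]
  have hLone : ∀ z ∈ ({z₀, conj z₀} : Finset ℂ), L z = 1 := by
    intro z hz
    rcases hmem z hz with rfl | rfl
    · exact hL1
    · rw [hLconj, hL1, map_one]
  have hnoroot := eventually_no_root_pencil hdegEN (Z := {z₀, conj z₀})
    (fun s hs hsZ => by
      have h1 : ‖tf g s‖ < γ := by
        have hseq : s = s.im * Complex.I := by apply Complex.ext <;> simp [hs]
        rw [tf_eq_freq g hs]
        refine hpk.2 _ (fun h => hsZ ?_) (fun h => hsZ ?_)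
        · rw [hseq, h]; simp [hz₀]
        · rw [hseq, h]; simp [hz₀]
      have hE' := norm_pos_iff.2 (hE0 s hs)
      have h2 : ‖L s‖ < 1 := by
        rw [hLeq, norm_mul, norm_inv, Complex.norm_real, Real.norm_of_nonneg hγ0.le, norm_mul,
          norm_div]
        have h3 : ‖aeval s a‖ / ‖aeval s b‖ ≤ 1 :=
          div_le_one_of_le₀ (hab s hs.ge) (norm_nonneg _)
        calc γ⁻¹ * (‖aeval s a‖ / ‖aeval s b‖ * ‖tf g s‖) ≤ γ⁻¹ * (1 * ‖tf g s‖) := by gcongr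
          _ < γ⁻¹ * (1 * γ) := by gcongr
          _ = 1 := by field_simp
      rw [hL] at h2
      simp only [norm_div] at h2
      rwa [div_lt_one hE'] at h2)
    hre (fun z hz => hE0 z (hre z hz))
    (fun z hz => (div_eq_one_iff_eq (hE0 z (hre z hz))).1 (hLone z hz))
    (fun z hz => ⟨ψ, hψ0, by
      rcases hmem z hz with rfl | rfl
      · exact hLd
      · exact hLd'⟩) hcount
  have hle : ∀ᶠ c : ℝ in 𝓝[>] 1, rir g ≤ ENNReal.ofReal (c * γ⁻¹) := by
    filter_upwards [hnoroot, self_mem_nhdsWithin] with c hc hc1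
    have hc0 : 0 < c := one_pos.trans hc1
    have h1 := div_mem_stabilizing (g := g) (a := C c * n) (b := b) (M := c * γ⁻¹) hb
      (fun s hs => by
        rw [hn, map_mul, map_mul, aeval_C, aeval_C, norm_mul, norm_mul, ← mul_assoc]
        simp only [Complex.coe_algebraMap, Complex.norm_real]
        rw [Real.norm_of_nonneg hc0.le, Real.norm_of_nonneg (inv_pos.2 hγ0).le]
        have := hab s hs
        gcongr)
      (fun s hs h => hc s hs (by
        rw [IsRoot, eval_sub, eval_mul, eval_C, hEv, hN, eval_map_algebraMap]
        rw [map_sub, mul_assoc, map_mul, map_mul (aeval s) (C c), aeval_C] at h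
        exact h))
    exact (iInf₂_le _ h1.1).trans h1.2
  have hlim : Tendsto (fun c : ℝ => ENNReal.ofReal (c * γ⁻¹)) (𝓝[>] 1)
      (𝓝 (ENNReal.ofReal (1 * γ⁻¹))) :=
    (ENNReal.continuous_ofReal.comp (continuous_mul_const γ⁻¹)).continuousAt.tendsto.mono_left
      nhdsWithin_le_nhds
  have := ge_of_tendsto hlim hle
  rwa [one_mul, ENNReal.ofReal_inv_of_pos hγ0, hγ, ofReal_norm, ← hpk.1] at this

end RobustInstability

theorem mainTheorem2 :
    (∀ g ∈ classGnZero 1, ∀ θ : ℝ → ℝ, IsPhase g θ →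
      (0 < deriv θ 0 → rir g = (linfNorm g)⁻¹ ∧ (linfNorm g)⁻¹ = ‖freq g 0‖ₑ⁻¹) ∧
      (rir g = (linfNorm g)⁻¹ → 0 ≤ deriv θ 0)) ∧
    (∀ g ∈ classGnSharp 2, ∀ ωp : ℝ, 0 < ωp → IsUniquePeak g ωp →
      ∀ θ : ℝ → ℝ, IsPhase g θ →
      (|Real.sin (θ ωp) / ωp| < deriv θ ωp →
        rir g = (linfNorm g)⁻¹ ∧ (linfNorm g)⁻¹ = ‖freq g ωp‖ₑ⁻¹) ∧
      (rir g = (linfNorm g)⁻¹ → |Real.sin (θ ωp) / ωp| ≤ deriv θ ωp)) ∧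
    (∀ g ∈ classGnSharp 1, (linfNorm g)⁻¹ < rir g) := by
  refine ⟨fun g hg θ hθ => ⟨fun hpos => ?_, deriv_phase_nonneg_of_rir_eq hg hθ⟩,
    fun g hg ωp hωp hpk θ hθ => ⟨fun hlt => ?_,
      abs_sin_div_le_deriv_phase_of_rir_eq hg.1.1 hωp hpk hθ⟩,
    fun g hg => inv_linfNorm_lt_rir_of_classGnSharp_one hg⟩
  · obtain ⟨⟨hG, h1, -⟩, hpk⟩ := hg
    refine ⟨le_antisymm (rir_le_of_abs_sin_div_lt_deriv_phase hG hpk hθ (Or.inr ?_) ?_ ?_)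
      (inv_linfNorm_le_rir hG), by rw [hpk.1]⟩
    · -- `g 0` is real, so its angle is a multiple of `π`.
      have h2 := hθ.2 0
      have h3 := congrArg Complex.im h2
      rw [freq_zero, tf_ofReal, Complex.ofReal_im, Complex.im_ofReal_mul,
        Complex.exp_ofReal_mul_I_im, ← tf_ofReal, ← freq_zero] at h3
      exact (mul_eq_zero.1 h3.symm).resolve_left (norm_ne_zero_iff.2 hpk.freq_ne_zero)
    · rw [h1]; simp
    · simpa using hpos
  · obtain ⟨⟨hG, h2, -⟩, -⟩ := hg
    refine ⟨le_antisymm (rir_le_of_abs_sin_div_lt_deriv_phase hG hpk hθ (Or.inl hωp) ?_ hlt)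
      (inv_linfNorm_le_rir hG), by rw [hpk.1]⟩
    rw [h2, Finset.card_pair]
    intro h
    have := congrArg Complex.im h
    simp at this
    linarith
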